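/- Let $\Sigma$ be a countable index set and, for each $\sigma\in\Sigma$, let $S_\sigma\subseteq\mathbb R$ be a Borel set (the energy spectrum of $\sigma$; for instance $S_\sigma=(0,\infty)$ or $S_\sigma=\mathbb R$). Let $\mathcal H$ be the Hilbert space of wave functions $\psi=(\psi_\sigma(E))$, $\sigma\in\Sigma$, $E\in\mathbb R$, with $\psi_\sigma(E)=0$ for $E\notin S_\sigma$ and norm $$\|\psi\|^2=\int\sum_\sigma|\psi_\sigma(E)|^2\,dE<\infty ,$$ and let $U(s)$, $s\in\mathbb R$, be the time translations $(U(s)\psi)_\sigma(E)=e^{isE}\psi_\sigma(E)$. A normalized covariant POV measure is a map $\tau$ from the Borel subsets of $\mathbb R$ to the bounded positive operators on $\mathcal H$ that is weakly countably additive, with $\tau(\emptyset)=0$, $\tau(\mathbb R)=1$ and $U(s)^\dagger\,\tau(I+s)\,U(s)=\tau(I)$ for all $s\in\mathbb R$ and all Borel sets $I$. A map $\tau$ from the Borel subsets of $\mathbb R$ to the bounded operators on $\mathcal H$ is a normalized covariant POV measure if and only if there are a countable index set $\Gamma$ and measurable functions $F_{\gamma\sigma}:\mathbb R\to\mathbb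 C$ ($\gamma\in\Gamma$, $\sigma\in\Sigma$) with $$\sum_\gamma\overline{F_{\gamma\sigma}(E)}\,F_{\gamma\sigma'}(E)=\delta_{\sigma\sigma'}\qquad\text{for all }\sigma,\sigma'\text{ and almost every }E\in S_\sigma\cap S_{\sigma'},$$ such that for every $\psi\in\mathcal H$ and every Borel set $I$ $$(\psi,\tau(I)\psi)=\int_I\rho(\psi,t)\,dt,\qquad \rho(\psi,t)=\sum_\gamma|\Psi_\gamma(t)|^2,$$ $$\Psi_\gamma(t)=(2\pi)^{-1/2}\int e^{-itE}\sum_\sigma F_{\gamma\sigma}(E)\,\psi_\sigma(E)\,dE,$$ where all sums converge almost everywhere, $\sum_\sigma F_{\gamma\sigma}\psi_\sigma$ and $\Psi_\gamma$ are square integrable, and $\rho(\psi,\cdot)$ is integrable. The integral defining $\Psi_\gamma$ is an ordinary integral when $\sum_\sigma F_{\gamma\sigma}\psi_\sigma$ is integrable, and in general the limit in $L^2(\mathbb R)$ of the integrals over $[-R,R]$ as $R\to\infty$. Moreover, every family $F$ of measurable functions that satisfies the displayed orthonormality condition, for a countable $\Gamma$, arises in this way from some such $\tau$. -/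

import Mathlib

open MeasureTheory Filter Topology

namespace TimePOVM

noncomputable section

variable {ι : Type*}

/-- The phase `exp (i s E)`. -/
def phase (s : ℝ) (p : ι × ℝ) : ℂ := Complex.exp (Complex.I * s * p.2)

theorem norm_phase (s : ℝ) (p : ι × ℝ) : ‖phase s p‖ = 1 := by
  have h : Complex.I * s * p.2 = ((s * p.2 : ℝ) : ℂ) * Complex.I := by
    push_cast
    ring
  rw [phase, h, Complex.norm_exp_ofReal_mul_I]

variable [MeasurableSpace ι]

/-- The measure on pairs `(σ, E)`: counting measure in the index `σ`, Lebesgue measure in the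
energy `E`, restricted to the pairs for which `E` lies in the spectrum `S σ` of the index `σ`. -/
def stateMeasure (S : ι → Set ℝ) : Measure (ι × ℝ) :=
  ((Measure.count : Measure ι).prod (volume : Measure ℝ)).restrict {p | p.2 ∈ S p.1}

/-- The Hilbert space of wave functions `ψ_σ(E)`, `E ∈ S σ`, with
`‖ψ‖² = ∫ ∑_σ |ψ_σ(E)|² dE`. -/
abbrev StateSpace (S : ι → Set ℝ) : Type _ := Lp ℂ 2 (stateMeasure S)

/-- The component `ψ_σ(E)` of a wave function, extended by `0` outside the spectrum `S σ`. -/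
def component (S : ι → Set ℝ) (ψ : StateSpace S) (σ : ι) : ℝ → ℂ :=
  (S σ).indicator fun E => ψ (σ, E)

theorem measurable_phase (s : ℝ) : Measurable (phase (ι := ι) s) := by
  unfold phase
  fun_prop

theorem memLp_phase_mul (S : ι → Set ℝ) (s : ℝ) (ψ : StateSpace S) :
    MemLp (fun p => phase s p * ψ p) 2 (stateMeasure S) := by
  refine (Lp.memLp ψ).of_le
    ((measurable_phase s).aestronglyMeasurable.mul (Lp.aestronglyMeasurable ψ))
    (Eventually.of_forall fun p => ?_)
  rw [norm_mul, norm_phase, one_mul]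

/-- The unitary time translation `U(s) = exp (i s H)`, where `H` is the energy operator
(multiplication by `E`): `(U(s) ψ)_σ(E) = exp (i s E) ψ_σ(E)`. -/
def timeTranslation (S : ι → Set ℝ) (s : ℝ) : StateSpace S →L[ℂ] StateSpace S :=
  LinearMap.mkContinuous
    { toFun := fun ψ => (memLp_phase_mul S s ψ).toLp
      map_add' := fun ψ φ => by
        apply Lp.ext
        filter_upwards [MemLp.coeFn_toLp (memLp_phase_mul S s (ψ + φ)),
          MemLp.coeFn_toLp (memLp_phase_mul S s ψ), MemLp.coeFn_toLp (memLp_phase_mul S s φ),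
          Lp.coeFn_add ψ φ, Lp.coeFn_add (memLp_phase_mul S s ψ).toLp
            (memLp_phase_mul S s φ).toLp] with p h1 h2 h3 h4 h5
        rw [h1, h5, Pi.add_apply, h2, h3, h4, Pi.add_apply, mul_add]
      map_smul' := fun c ψ => by
        apply Lp.ext
        filter_upwards [MemLp.coeFn_toLp (memLp_phase_mul S s (c • ψ)),
          MemLp.coeFn_toLp (memLp_phase_mul S s ψ),
          Lp.coeFn_smul c ψ, Lp.coeFn_smul c (memLp_phase_mul S s ψ).toLp] with p h1 h2 h3 h4
        simp only [RingHom.id_apply]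
        rw [h1, h4, Pi.smul_apply, h2, h3, Pi.smul_apply, smul_eq_mul, smul_eq_mul]
        ring }
    1 (fun ψ => by
      rw [one_mul]
      refine Lp.norm_le_norm_of_ae_le ?_
      filter_upwards [MemLp.coeFn_toLp (memLp_phase_mul S s ψ)] with p h1
      simp only [LinearMap.coe_mk, AddHom.coe_mk]
      rw [h1, norm_mul, norm_phase, one_mul])

/-- A normalized positive operator valued measure on the Borel sets of the real line
(only the values of `τ` on Borel sets matter; countable additivity is in the weak sense). -/
structure IsNormalizedPOVM {H : Type*} [NormedAddCommGroup H] [InnerProductSpace ℂ H]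
    (τ : Set ℝ → H →L[ℂ] H) : Prop where
  positive : ∀ I, MeasurableSet I → (τ I).IsPositive
  empty : τ ∅ = 0
  iUnion : ∀ I : ℕ → Set ℝ, (∀ n, MeasurableSet (I n)) → Pairwise (Function.onFun Disjoint I) →
    ∀ φ ψ : H, HasSum (fun n => inner ℂ φ (τ (I n) ψ)) (inner ℂ φ (τ (⋃ n, I n) ψ))
  normalized : τ Set.univ = 1

/-- Covariance under time translations: `U(s)† τ(I + s) U(s) = τ(I)`. -/
def IsCovariant (S : ι → Set ℝ) (τ : Set ℝ → StateSpace S →L[ℂ] StateSpace S) : Prop :=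
  ∀ (s : ℝ) (I : Set ℝ), MeasurableSet I →
    (ContinuousLinearMap.adjoint (timeTranslation S s)) ∘L τ ((fun t => t + s) '' I) ∘L
      timeTranslation S s = τ I

open Classical in
/-- The matrix functions `F_{γσ}(E)`: measurable, and with orthonormal columns,
`∑_γ conj (F_{γσ}(E)) F_{γσ'}(E) = δ_{σσ'}`, for almost every `E` in the spectra of `σ`, `σ'`. -/
structure IsIsometricKernel (S : ι → Set ℝ) {Γ : Type*} (F : Γ → ι → ℝ → ℂ) : Prop where
  measurable : ∀ γ σ, Measurable (F γ σ)
  orthonormal : ∀ σ σ', ∀ᵐ E, E ∈ S σ → E ∈ S σ' →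
    HasSum (fun γ => starRingEnd ℂ (F γ σ E) * F γ σ' E) (if σ = σ' then 1 else 0)

/-- `∑_σ F_{γσ}(E) ψ_σ(E)`. -/
def energyAmplitude (S : ι → Set ℝ) {Γ : Type*} (F : Γ → ι → ℝ → ℂ) (ψ : StateSpace S)
    (γ : Γ) (E : ℝ) : ℂ :=
  ∑' σ, F γ σ E * component S ψ σ E

/-- `Ψ(t) = (2π)^{-1/2} ∫ exp (-i t E) Φ(E) dE` for a square integrable function `Φ`:
literally, for every `t`, if `Φ` is also integrable, and in general as the limit in square mean
of the integrals over `[-R, R]` as `R → ∞`. -/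
structure IsFourierOf (Φ Ψ : ℝ → ℂ) : Prop where
  memLp_left : MemLp Φ 2 volume
  memLp_right : MemLp Ψ 2 volume
  eq_integral : Integrable Φ volume → ∀ t : ℝ,
    Ψ t = ((Real.sqrt (2 * Real.pi))⁻¹ : ℝ) * ∫ E : ℝ, Complex.exp (-Complex.I * t * E) * Φ E
  tendsto : Tendsto (fun R : ℝ => eLpNorm (fun t : ℝ => Ψ t -
      ((Real.sqrt (2 * Real.pi))⁻¹ : ℝ) *
        ∫ E : ℝ in (-R)..R, Complex.exp (-Complex.I * t * E) * Φ E) 2 volume) atTop (𝓝 0)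

/-- For every state `ψ`, the measure `I ↦ (ψ, τ(I) ψ)` has the integrable density
`ρ(ψ, t) = ∑_γ |Ψ_γ(t)|²`, where `Ψ_γ` is the Fourier transform of
`E ↦ ∑_σ F_{γσ}(E) ψ_σ(E)`. All sums converge almost everywhere. -/
def HasDensity (S : ι → Set ℝ) (τ : Set ℝ → StateSpace S →L[ℂ] StateSpace S)
    {Γ : Type*} (F : Γ → ι → ℝ → ℂ) : Prop :=
  ∀ ψ : StateSpace S,
    (∀ γ, ∀ᵐ E, Summable fun σ => F γ σ E * component S ψ σ E) ∧
    ∃ Ψ : Γ → ℝ → ℂ,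
      (∀ γ, IsFourierOf (energyAmplitude S F ψ γ) (Ψ γ)) ∧
      (∀ᵐ t, Summable fun γ => ‖Ψ γ t‖ ^ 2) ∧
      Integrable (fun t => ∑' γ, ‖Ψ γ t‖ ^ 2) volume ∧
      ∀ I, MeasurableSet I →
        inner ℂ ψ (τ I ψ) = ((∫ t in I, ∑' γ, ‖Ψ γ t‖ ^ 2 : ℝ) : ℂ)

end

end TimePOVM

namespace TimePOVM

noncomputable section

open scoped FourierTransform SchwartzMap ContDiff ENNReal

/-! ### Fourier transforms of integrable and of square integrable functions -/

section

/-! From `F` to `τ`: a matrix with orthonormal columns is isometric at almost every energy, so with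
Plancherel `∫ ρ(ψ, t) dt = ‖ψ‖²`. For each `I` the form `ψ ↦ ∫_I ρ(ψ, t) dt` has the shape `‖Vψ‖²`
and belongs to the bounded operator `V†V` (`exists_hasDensity`). Additivity and normalization pass
from these forms to operators by polarization, and covariance holds because a phase in the energy is
a shift in time.

From `τ` to `F`: a general state need not have a time density with a meaningful value at each point,
so states are first smoothed by the resolvent `R = (1 - iH)⁻¹ = ∫_0^∞ exp(-s) U(s) ds`. Covariance
and Tonelli give `∫ (U(s)ψ, τ(I) U(s)ψ) ds = |I| ‖ψ‖²`, whence `(Rψ, τ(I) Rψ) ≤ |I| ‖ψ‖²`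
(`measure_resolvent_le`). The operators `R† τ([-ε, ε]) R / 2ε` are therefore bounded by `1` and have
a weak limit point `B†B`. By Lebesgue differentiation and covariance, the density of `Rψ` at almost
every `t` is `‖B U(-t)ψ‖²` (`exists_density_operator`). Expanding in an orthonormal basis `e_γ`
turns it into `∑_γ |(b_γ, U(-t)ψ)|²` with `b_γ = B† e_γ`; each term is a Fourier integral in `E`,
from which the kernel `F_{γσ}(E) = √(2π) (1 - iE) conj (b_{γσ}(E))` is read off (`exists_kernel`).

Finally `τ(ℝ) = 1` and Plancherel say that `F` acts isometrically on the range of `R`. Testing on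
states supported in small sets of energies gives orthonormal columns
(`isIsometricKernel_of_isometric`), and since the range of `R` is dense, `τ` is the measure built
from `F` (`exists_isIsometricKernel_hasDensity`). -/

theorem ae_eq_of_integral_schwartz_smul_eq {f g : ℝ → ℂ} (hf : LocallyIntegrable f)
    (hg : LocallyIntegrable g) (h : ∀ s : 𝓢(ℝ, ℂ), ∫ x, s x • f x = ∫ x, s x • g x) :
    f =ᵐ[volume] g := by
  refine ae_eq_of_integral_contDiff_smul_eq hf hg fun s hs hc => ?_
  have hg₁ : HasCompactSupport (Complex.ofRealCLM ∘ s) := hc.comp_left rfl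
  have hg₂ : ContDiff ℝ ∞ (Complex.ofRealCLM ∘ s) := by fun_prop
  simpa using h (hg₁.toSchwartzMap hg₂)

theorem integral_fourier_smul_eq {f g : ℝ → ℂ} (hf : Integrable f) (hg : Integrable g) :
    ∫ x, 𝓕 f x • g x = ∫ x, f x • 𝓕 g x := by
  have := VectorFourier.integral_fourierIntegral_smul_eq_flip (L := innerₗ ℝ)
    Real.continuous_fourierChar continuous_inner hf hg
  rwa [flip_innerₗ] at this

/-- Both transforms are the same tempered distribution: paired with a Schwartz function `s`, each
gives `∫ 𝓕 s • f`. -/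
theorem Lp_fourier_ae_eq {f : ℝ → ℂ} (h1 : Integrable f) (h2 : MemLp f 2) :
    (𝓕 h2.toLp : Lp ℂ 2 (volume : Measure ℝ)) =ᵐ[volume] 𝓕 f := by
  refine ae_eq_of_integral_schwartz_smul_eq ((Lp.memLp _).locallyIntegrable one_le_two)
    (Continuous.locallyIntegrable ?_) fun s => ?_
  · exact VectorFourier.fourierIntegral_continuous Real.continuous_fourierChar
      continuous_inner h1
  · rw [← Lp.toTemperedDistribution_apply, ← Lp.fourier_toTemperedDistribution_eq,
      TemperedDistribution.fourier_apply, Lp.toTemperedDistribution_apply,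
      ← integral_fourier_smul_eq s.integrable h1, SchwartzMap.fourier_coe]
    refine integral_congr_ae ?_
    filter_upwards [h2.coeFn_toLp] with x hx
    rw [hx]

/-- As a distribution, `f` is the inverse `L²` transform of `𝓕 f`. This is needed because the
amplitudes obtained from `τ` are a priori only integrable in the energy, while square integrability
is known on the time side. -/
theorem memLp_of_fourier_memLp {f : ℝ → ℂ} (h1 : Integrable f) (h2 : MemLp (𝓕 f) 2) :
    MemLp f 2 := by
  have h : f =ᵐ[volume] (𝓕⁻ h2.toLp : Lp ℂ 2 (volume : Measure ℝ)) := by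
    refine ae_eq_of_integral_schwartz_smul_eq h1.locallyIntegrable
      ((Lp.memLp _).locallyIntegrable one_le_two) fun s => ?_
    rw [← Lp.toTemperedDistribution_apply, ← Lp.fourierInv_toTemperedDistribution_eq,
      TemperedDistribution.fourierInv_apply, Lp.toTemperedDistribution_apply]
    have e : ∀ x, s x = 𝓕 (⇑(𝓕⁻ s : 𝓢(ℝ, ℂ))) x := fun x => by
      rw [← SchwartzMap.fourier_coe, FourierTransform.fourier_fourierInv_eq]
    simp_rw [e]
    rw [integral_fourier_smul_eq (𝓕⁻ s : 𝓢(ℝ, ℂ)).integrable h1]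
    refine integral_congr_ae ?_
    filter_upwards [h2.coeFn_toLp] with x hx
    rw [hx]
  exact (memLp_congr_ae h).2 (Lp.memLp _)

/-- `(2π)^{-1/2} ∫ exp (-i t E) Φ(E) dE`. -/
def timeAmplitude (Φ : ℝ → ℂ) (t : ℝ) : ℂ :=
  ((Real.sqrt (2 * Real.pi))⁻¹ : ℝ) * ∫ E : ℝ, Complex.exp (-Complex.I * t * E) * Φ E

/-- The rescaling of the Fourier variable from frequency to angular frequency. -/
def rescale (Ψ : ℝ → ℂ) (t : ℝ) : ℂ := ((Real.sqrt (2 * Real.pi))⁻¹ : ℝ) * Ψ (t / (2 * Real.pi))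

theorem timeAmplitude_eq_rescale (Φ : ℝ → ℂ) : timeAmplitude Φ = rescale (𝓕 Φ) := by
  funext t
  rw [timeAmplitude, rescale, Real.fourier_real_eq_integral_exp_smul]
  congr 2
  funext E
  rw [smul_eq_mul]
  congr 2
  have : (Real.pi : ℂ) ≠ 0 := by exact_mod_cast Real.pi_ne_zero
  push_cast
  field_simp

/-! ### Rescaling from frequency to time -/

theorem measurableEmbedding_div_two_pi :
    MeasurableEmbedding (fun t : ℝ => t / (2 * Real.pi)) := by
  simp_rw [div_eq_mul_inv]
  exact (Homeomorph.mulRight₀ (2 * Real.pi)⁻¹ (by positivity)).measurableEmbedding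

theorem map_div_two_pi : Measure.map (fun t : ℝ => t / (2 * Real.pi)) volume
    = ENNReal.ofReal (2 * Real.pi) • volume := by
  have hpos : 0 < 2 * Real.pi := by positivity
  have h : (fun t : ℝ => t / (2 * Real.pi)) = fun t => t * (2 * Real.pi)⁻¹ := by
    funext t; rw [div_eq_mul_inv]
  rw [h, Real.map_volume_mul_right (by positivity), inv_inv, abs_of_pos hpos]

theorem quasiMeasurePreserving_div_two_pi :
    Measure.QuasiMeasurePreserving (fun t : ℝ => t / (2 * Real.pi)) volume volume := by
  refine ⟨by fun_prop, ?_⟩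
  rw [map_div_two_pi]
  exact Measure.AbsolutelyContinuous.smul_left Measure.AbsolutelyContinuous.rfl _

theorem enorm_rescale_sq (Ψ : ℝ → ℂ) (t : ℝ) : ‖rescale Ψ t‖ₑ ^ 2
    = (ENNReal.ofReal (2 * Real.pi))⁻¹ * ‖Ψ (t / (2 * Real.pi))‖ₑ ^ 2 := by
  have hpos : 0 < 2 * Real.pi := by positivity
  rw [rescale, enorm_mul, mul_pow]
  congr 1
  rw [← ofReal_norm, Complex.norm_real, Real.norm_of_nonneg (by positivity),
    ← ENNReal.ofReal_pow (by positivity), inv_pow, Real.sq_sqrt hpos.le,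
    ENNReal.ofReal_inv_of_pos hpos]

/-- The factor `(2π)^{-1/2}` makes the dilation unitary: its square cancels the Jacobian `2π`. -/
theorem setLIntegral_rescale (Ψ : ℝ → ℂ) (I : Set ℝ) :
    ∫⁻ t in (fun t : ℝ => t / (2 * Real.pi)) ⁻¹' I, ‖rescale Ψ t‖ₑ ^ 2
      = ∫⁻ t in I, ‖Ψ t‖ₑ ^ 2 := by
  have hpos : 0 < 2 * Real.pi := by positivity
  have e := measurableEmbedding_div_two_pi
  simp_rw [enorm_rescale_sq]
  rw [lintegral_const_mul' _ _ (by simp [Real.pi_pos]),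
    ← e.lintegral_map (fun t => ‖Ψ t‖ₑ ^ 2), ← e.restrict_map, map_div_two_pi,
    Measure.restrict_smul, lintegral_smul_measure, smul_eq_mul, ← mul_assoc,
    ENNReal.inv_mul_cancel (by simp [Real.pi_pos]) ENNReal.ofReal_ne_top, one_mul]

theorem rescale_congr_ae {Ψ Ψ' : ℝ → ℂ} (h : Ψ =ᵐ[volume] Ψ') :
    rescale Ψ =ᵐ[volume] rescale Ψ' := by
  filter_upwards [quasiMeasurePreserving_div_two_pi.ae h] with t ht
  rw [rescale, rescale, ht]

theorem aestronglyMeasurable_rescale {Ψ : ℝ → ℂ} (h : AEStronglyMeasurable Ψ) :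
    AEStronglyMeasurable (rescale Ψ) :=
  (h.comp_quasiMeasurePreserving quasiMeasurePreserving_div_two_pi).const_mul _

theorem eLpNorm_two_eq {α : Type*} [MeasurableSpace α] (μ : Measure α) (f : α → ℂ) :
    eLpNorm f 2 μ = (∫⁻ x, ‖f x‖ₑ ^ 2 ∂μ) ^ (1 / 2 : ℝ) := by
  rw [eLpNorm_eq_lintegral_rpow_enorm_toReal two_ne_zero ENNReal.ofNat_ne_top]
  simp

theorem lintegral_sq_eq {α : Type*} [MeasurableSpace α] (μ : Measure α) (f : α → ℂ) :
    ∫⁻ x, ‖f x‖ₑ ^ 2 ∂μ = eLpNorm f 2 μ ^ 2 := by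
  rw [eLpNorm_two_eq, ← ENNReal.rpow_natCast, ← ENNReal.rpow_mul]
  simp

theorem memLp_two_iff {α : Type*} [MeasurableSpace α] {μ : Measure α} {f : α → ℂ}
    (hf : AEStronglyMeasurable f μ) : MemLp f 2 μ ↔ ∫⁻ x, ‖f x‖ₑ ^ 2 ∂μ < ⊤ := by
  rw [lintegral_sq_eq, MemLp, and_iff_right hf, ENNReal.pow_lt_top_iff]
  simp

theorem lintegral_rescale (Ψ : ℝ → ℂ) :
    ∫⁻ t, ‖rescale Ψ t‖ₑ ^ 2 = ∫⁻ t, ‖Ψ t‖ₑ ^ 2 := by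
  simpa using setLIntegral_rescale Ψ Set.univ

theorem eLpNorm_rescale (Ψ : ℝ → ℂ) : eLpNorm (rescale Ψ) 2 volume = eLpNorm Ψ 2 volume := by
  rw [eLpNorm_two_eq, eLpNorm_two_eq, lintegral_rescale]

theorem memLp_rescale_iff {Ψ : ℝ → ℂ} (h : AEStronglyMeasurable Ψ) :
    MemLp (rescale Ψ) 2 volume ↔ MemLp Ψ 2 volume := by
  rw [memLp_two_iff h, memLp_two_iff (aestronglyMeasurable_rescale h), lintegral_rescale]

theorem continuous_fourier {f : ℝ → ℂ} (h1 : Integrable f) : Continuous (𝓕 f) :=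
  VectorFourier.fourierIntegral_continuous Real.continuous_fourierChar continuous_inner h1

/-- Plancherel's identity for an integrable function whose Fourier integral is square
integrable. -/
theorem lintegral_timeAmplitude {f : ℝ → ℂ} (h1 : Integrable f)
    (h2 : ∫⁻ t, ‖timeAmplitude f t‖ₑ ^ 2 < ⊤) :
    ∫⁻ E, ‖f E‖ₑ ^ 2 = ∫⁻ t, ‖timeAmplitude f t‖ₑ ^ 2 := by
  rw [timeAmplitude_eq_rescale, lintegral_rescale] at h2 ⊢
  have hm := memLp_of_fourier_memLp h1
    ((memLp_two_iff (continuous_fourier h1).aestronglyMeasurable).2 h2)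
  rw [lintegral_sq_eq, lintegral_sq_eq, ← eLpNorm_congr_ae (Lp_fourier_ae_eq h1 hm),
    ← eLpNorm_congr_ae hm.coeFn_toLp, ← Lp.enorm_def, ← Lp.enorm_def, ← ofReal_norm,
    ← ofReal_norm, Lp.norm_fourier_eq]

/-- The Fourier transform of a square integrable function, rescaled. -/
def timeLp (φ : Lp ℂ 2 (volume : Measure ℝ)) : ℝ → ℂ :=
  rescale (𝓕 φ : Lp ℂ 2 (volume : Measure ℝ))

theorem memLp_timeLp (φ : Lp ℂ 2 (volume : Measure ℝ)) : MemLp (timeLp φ) 2 volume :=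
  (memLp_rescale_iff (Lp.aestronglyMeasurable _)).2 (Lp.memLp _)

/-! ### Truncated Fourier integrals and their limit in square mean -/

theorem integrable_truncation {Φ : ℝ → ℂ} (hΦ : MemLp Φ 2 volume) (R : ℝ) :
    Integrable ((Set.Ioc (-R) R).indicator Φ) :=
  (integrable_indicator_iff measurableSet_Ioc).2 ((hΦ.restrict _).integrable one_le_two)

theorem truncated_integral_eq (Φ : ℝ → ℂ) {R : ℝ} (hR : 0 ≤ R) :
    (fun t : ℝ => ((Real.sqrt (2 * Real.pi))⁻¹ : ℝ) *
      ∫ E : ℝ in (-R)..R, Complex.exp (-Complex.I * t * E) * Φ E)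
      = timeAmplitude ((Set.Ioc (-R) R).indicator Φ) := by
  funext t
  rw [timeAmplitude, intervalIntegral.integral_of_le (by linarith),
    ← integral_indicator measurableSet_Ioc]
  congr 2
  funext E
  by_cases hE : E ∈ Set.Ioc (-R) R <;> simp [hE]

theorem aestronglyMeasurable_truncated_integral {Φ : ℝ → ℂ} (hΦ : MemLp Φ 2 volume) {R : ℝ}
    (hR : 0 ≤ R) : AEStronglyMeasurable (fun t : ℝ => ((Real.sqrt (2 * Real.pi))⁻¹ : ℝ) *
      ∫ E : ℝ in (-R)..R, Complex.exp (-Complex.I * t * E) * Φ E) volume := by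
  rw [truncated_integral_eq Φ hR, timeAmplitude_eq_rescale]
  exact aestronglyMeasurable_rescale
    (continuous_fourier (integrable_truncation hΦ R)).aestronglyMeasurable

/-- The rescaled transform is isometric, so the error is the `L²` norm of `Φ` outside `(-R, R]`,
which vanishes in the limit by dominated convergence. -/
theorem tendsto_truncation {Φ : ℝ → ℂ} (hΦ : MemLp Φ 2 volume) :
    Tendsto (fun R : ℝ => eLpNorm (fun t : ℝ => timeLp hΦ.toLp t -
      ((Real.sqrt (2 * Real.pi))⁻¹ : ℝ) *
        ∫ E : ℝ in (-R)..R, Complex.exp (-Complex.I * t * E) * Φ E) 2 volume) atTop (𝓝 0) := by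
  have key : ∀ R : ℝ, 0 ≤ R → eLpNorm (fun t : ℝ => timeLp hΦ.toLp t -
      ((Real.sqrt (2 * Real.pi))⁻¹ : ℝ) *
        ∫ E : ℝ in (-R)..R, Complex.exp (-Complex.I * t * E) * Φ E) 2 volume
      = eLpNorm (fun E => Φ E - (Set.Ioc (-R) R).indicator Φ E) 2 volume := by
    intro R hR
    have hm : MemLp ((Set.Ioc (-R) R).indicator Φ) 2 volume := hΦ.indicator measurableSet_Ioc
    have hi := integrable_truncation hΦ R
    have e1 := truncated_integral_eq Φ hR
    have e2 : (fun t : ℝ => timeLp hΦ.toLp t - ((Real.sqrt (2 * Real.pi))⁻¹ : ℝ) *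
        ∫ E : ℝ in (-R)..R, Complex.exp (-Complex.I * t * E) * Φ E)
        =ᵐ[volume] rescale (𝓕 (hΦ.toLp - hm.toLp) : Lp ℂ 2 (volume : Measure ℝ)) := by
      have h3 : rescale (𝓕 (hΦ.toLp - hm.toLp) : Lp ℂ 2 (volume : Measure ℝ)) =ᵐ[volume]
          rescale (fun x => (𝓕 hΦ.toLp : Lp ℂ 2 (volume : Measure ℝ)) x -
            𝓕 ((Set.Ioc (-R) R).indicator Φ) x) := by
        refine rescale_congr_ae ?_
        rw [show (𝓕 (hΦ.toLp - hm.toLp) : Lp ℂ 2 (volume : Measure ℝ)) = 𝓕 hΦ.toLp - 𝓕 hm.toLp from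
          map_sub (Lp.fourierTransformₗᵢ ℝ ℂ) _ _]
        filter_upwards [Lp.coeFn_sub (𝓕 hΦ.toLp : Lp ℂ 2 (volume : Measure ℝ)) (𝓕 hm.toLp),
          Lp_fourier_ae_eq hi hm] with x h4 h5
        rw [h4, Pi.sub_apply, h5]
      filter_upwards [h3] with t h4
      rw [h4, congrFun e1 t, timeAmplitude_eq_rescale, timeLp, rescale, rescale, rescale, mul_sub]
    rw [eLpNorm_congr_ae e2, eLpNorm_rescale, ← Lp.enorm_def]
    have : ‖(𝓕 (hΦ.toLp - hm.toLp) : Lp ℂ 2 (volume : Measure ℝ))‖ₑ = ‖hΦ.toLp - hm.toLp‖ₑ := by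
      rw [← ofReal_norm, ← ofReal_norm, Lp.norm_fourier_eq]
    rw [this, Lp.enorm_def]
    refine eLpNorm_congr_ae ?_
    filter_upwards [Lp.coeFn_sub hΦ.toLp hm.toLp, hΦ.coeFn_toLp, hm.coeFn_toLp] with x h4 h5 h6
    rw [h4, Pi.sub_apply, h5, h6]
  have lim : Tendsto (fun R : ℝ => eLpNorm (fun E => Φ E - (Set.Ioc (-R) R).indicator Φ E) 2 volume)
      atTop (𝓝 0) := by
    have h5 : Tendsto (fun R : ℝ => ∫⁻ E, ‖Φ E - (Set.Ioc (-R) R).indicator Φ E‖ₑ ^ 2) atTop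
        (𝓝 (∫⁻ _ : ℝ, 0)) := by
      refine tendsto_lintegral_filter_of_dominated_convergence' (fun E => ‖Φ E‖ₑ ^ 2)
        (Eventually.of_forall fun R => ?_) (Eventually.of_forall fun R =>
          Eventually.of_forall fun E => ?_) ?_ (Eventually.of_forall fun E => ?_)
      · exact ((hΦ.1.sub (hΦ.1.indicator measurableSet_Ioc)).enorm).pow_const 2
      · by_cases hE : E ∈ Set.Ioc (-R) R <;> simp [hE]
      · exact ((memLp_two_iff hΦ.1).1 hΦ).ne
      · refine tendsto_const_nhds.congr' ?_
        filter_upwards [eventually_gt_atTop |E|] with R hR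
        have : E ∈ Set.Ioc (-R) R := ⟨(abs_lt.1 hR).1, (abs_lt.1 hR).2.le⟩
        simp [this]
    simp_rw [eLpNorm_two_eq]
    have := h5.ennrpow_const (1 / 2 : ℝ)
    simpa using this
  refine lim.congr' ?_
  filter_upwards [eventually_ge_atTop 0] with R hR
  exact (key R hR).symm

theorem IsFourierOf.unique {Φ Φ' Ψ Ψ' : ℝ → ℂ} (hΦ : Φ =ᵐ[volume] Φ') (h : IsFourierOf Φ Ψ)
    (h' : IsFourierOf Φ' Ψ') : Ψ =ᵐ[volume] Ψ' := by
  have hT : ∀ R t : ℝ, ∫ E : ℝ in (-R)..R, Complex.exp (-Complex.I * t * E) * Φ E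
      = ∫ E : ℝ in (-R)..R, Complex.exp (-Complex.I * t * E) * Φ' E := fun R t => by
    refine intervalIntegral.integral_congr_ae ?_
    filter_upwards [hΦ] with E hE _
    rw [hE]
  have h1 := h.tendsto.add h'.tendsto
  rw [add_zero] at h1
  have h2 : eLpNorm (Ψ - Ψ') 2 volume ≤ 0 := by
    refine ge_of_tendsto h1 (eventually_ge_atTop 0 |>.mono fun R hR => ?_)
    simp_rw [hT]
    have e : Ψ - Ψ' = (fun t : ℝ => Ψ t - ((Real.sqrt (2 * Real.pi))⁻¹ : ℝ) *
        ∫ E : ℝ in (-R)..R, Complex.exp (-Complex.I * t * E) * Φ' E) -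
        fun t : ℝ => Ψ' t - ((Real.sqrt (2 * Real.pi))⁻¹ : ℝ) *
        ∫ E : ℝ in (-R)..R, Complex.exp (-Complex.I * t * E) * Φ' E := by
      funext t; simp
    have hc := aestronglyMeasurable_truncated_integral h'.memLp_left hR
    rw [e]
    exact eLpNorm_sub_le (h.memLp_right.1.sub hc) (h'.memLp_right.1.sub hc) one_le_two
  have h3 := (eLpNorm_eq_zero_iff (h.memLp_right.1.sub h'.memLp_right.1) two_ne_zero).1
    (le_antisymm h2 bot_le)
  filter_upwards [h3] with t ht
  exact sub_eq_zero.1 ht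

/-- Every square integrable function has a Fourier transform, given by `timeLp` almost
everywhere. -/
theorem exists_isFourierOf {Φ : ℝ → ℂ} (hΦ : MemLp Φ 2 volume) :
    ∃ Ψ, IsFourierOf Φ Ψ ∧ Ψ =ᵐ[volume] timeLp hΦ.toLp := by
  classical
  -- `IsFourierOf` prescribes the value at every `t` when `Φ` is integrable, so there the ordinary
  -- integral must be the representative.
  by_cases hi : Integrable Φ
  · have e : timeAmplitude Φ =ᵐ[volume] timeLp hΦ.toLp := by
      rw [timeAmplitude_eq_rescale]
      exact rescale_congr_ae (Lp_fourier_ae_eq hi hΦ).symm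
    refine ⟨timeAmplitude Φ, ⟨hΦ, (memLp_congr_ae e).2 (memLp_timeLp _), fun _ _ => rfl, ?_⟩, e⟩
    refine (tendsto_truncation hΦ).congr fun R => eLpNorm_congr_ae ?_
    filter_upwards [e] with t ht
    rw [ht]
  · exact ⟨timeLp hΦ.toLp, ⟨hΦ, memLp_timeLp _, fun h => absurd h hi, tendsto_truncation hΦ⟩,
      ae_eq_refl _⟩

theorem IsFourierOf.ae_eq_timeLp {Φ Ψ : ℝ → ℂ} (h : IsFourierOf Φ Ψ) :
    Ψ =ᵐ[volume] timeLp h.memLp_left.toLp := by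
  obtain ⟨Ψ', h', e⟩ := exists_isFourierOf h.memLp_left
  exact (h.unique (ae_eq_refl _) h').trans e

theorem lintegral_timeLp (φ : Lp ℂ 2 (volume : Measure ℝ)) :
    ∫⁻ t, ‖timeLp φ t‖ₑ ^ 2 = ∫⁻ E, ‖φ E‖ₑ ^ 2 := by
  rw [timeLp, lintegral_rescale, lintegral_sq_eq, lintegral_sq_eq, ← Lp.enorm_def, ← Lp.enorm_def,
    ← ofReal_norm, ← ofReal_norm, Lp.norm_fourier_eq]

/-- Multiplication by a phase in the energy shifts the Fourier transform in time. -/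
theorem IsFourierOf.shift {Φ Ψ : ℝ → ℂ} (h : IsFourierOf Φ Ψ) (s : ℝ) :
    IsFourierOf (fun E => Complex.exp (Complex.I * s * E) * Φ E) (fun t => Ψ (t - s)) := by
  have hn : ∀ E : ℝ, ‖Complex.exp (Complex.I * s * E)‖ = 1 := fun E => by
    have h : Complex.I * s * E = ((s * E : ℝ) : ℂ) * Complex.I := by
      push_cast
      ring
    rw [h, Complex.norm_exp_ofReal_mul_I]
  have hn' : ∀ E : ℝ, ‖Complex.exp (-Complex.I * s * E)‖ = 1 := fun E => by
    have h : -Complex.I * s * E = ((-(s * E) : ℝ) : ℂ) * Complex.I := by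
      push_cast
      ring
    rw [h, Complex.norm_exp_ofReal_mul_I]
  have hexp : ∀ t E : ℝ, Complex.exp (-Complex.I * t * E) * (Complex.exp (Complex.I * s * E) * Φ E)
      = Complex.exp (-Complex.I * (t - s : ℝ) * E) * Φ E := fun t E => by
    rw [← mul_assoc, ← Complex.exp_add]
    congr 2
    push_cast
    ring
  have hmp := measurePreserving_sub_right (volume : Measure ℝ) s
  refine ⟨h.memLp_left.of_le (AEStronglyMeasurable.mul (by fun_prop) h.memLp_left.1)
    (Eventually.of_forall fun E => by rw [norm_mul, hn, one_mul]),
    h.memLp_right.comp_measurePreserving hmp, fun hi t => ?_, ?_⟩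
  · have hi' : Integrable Φ := by
      refine hi.mono h.memLp_left.1 (Eventually.of_forall fun E => by rw [norm_mul, hn, one_mul])
    simp_rw [hexp]
    exact h.eq_integral hi' (t - s)
  · refine h.tendsto.congr' ?_
    filter_upwards [eventually_ge_atTop 0] with R hR
    simp_rw [hexp]
    have hc := h.memLp_right.1.sub (aestronglyMeasurable_truncated_integral h.memLp_left hR)
    exact (eLpNorm_comp_measurePreserving hc hmp).symm

end

section

/-! ### Isometric matrices -/

/-- A matrix whose columns in `A` are orthonormal acts isometrically on the square summable
families supported in `A`. -/
theorem hasSum_norm_sq_of_orthonormal_columns {ι Γ : Type*} [DecidableEq ι] (A : Set ι)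
    (f : Γ → ι → ℂ)
    (hf : ∀ σ ∈ A, ∀ σ' ∈ A, HasSum (fun γ => starRingEnd ℂ (f γ σ) * f γ σ')
      (if σ = σ' then 1 else 0))
    (x : ι → ℂ) (hx : ∀ σ ∉ A, x σ = 0) (hs : Summable fun σ => ‖x σ‖ ^ 2) :
    (∀ γ, Summable fun σ => f γ σ * x σ) ∧
      HasSum (fun γ => ‖∑' σ, f γ σ * x σ‖ ^ 2) (∑' σ, ‖x σ‖ ^ 2) := by
  classical
  have h2 : (0 : ℝ) < (2 : ℝ≥0∞).toReal := by simp
  have hmem : ∀ σ : A, Memℓp (fun γ => f γ σ) 2 := by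
    intro σ
    rw [memℓp_gen_iff h2]
    have h := hf σ σ.2 σ σ.2
    have h' : (fun γ => starRingEnd ℂ (f γ σ) * f γ σ) = fun γ => ((‖f γ σ‖ ^ 2 : ℝ) : ℂ) := by
      funext γ
      rw [mul_comm, Complex.mul_conj, Complex.normSq_eq_norm_sq]
    rw [h'] at h
    have := (Complex.summable_ofReal.1 h.summable)
    simpa using this
  let v : A → lp (fun _ : Γ => ℂ) 2 := fun σ => ⟨fun γ => f γ σ, hmem σ⟩
  have hv : Orthonormal ℂ v := by
    rw [orthonormal_iff_ite]
    intro σ σ'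
    have h1 := lp.hasSum_inner (𝕜 := ℂ) (v σ) (v σ')
    have h3 := hf σ σ.2 σ' σ'.2
    have h4 : (fun γ => inner ℂ (v σ γ) (v σ' γ))
        = fun γ => starRingEnd ℂ (f γ σ) * f γ σ' := by
      funext γ
      simp [v, mul_comm]
    rw [h4] at h1
    rw [h1.unique h3]
    simp only [Subtype.ext_iff]
  have hxmem : Memℓp (fun σ : A => x σ) 2 := by
    rw [memℓp_gen_iff h2]
    have := hs.comp_injective (i := ((↑) : A → ι)) Subtype.val_injective
    simpa [Function.comp_def] using this
  let y : lp (fun _ : A => ℂ) 2 := ⟨fun σ => x σ, hxmem⟩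
  -- The columns are orthonormal in `ℓ²(Γ)`, so they induce an isometry from `ℓ²(A)`. Its series
  -- converges in norm, and evaluating at `γ`, a continuous functional, gives the sums over `σ`.
  have hsum := hv.orthogonalFamily.hasSum_linearIsometry y
  set z := hv.orthogonalFamily.linearIsometry y with hz
  have hcoord : ∀ γ, HasSum (fun σ => f γ σ * x σ) (z γ) := by
    intro γ
    have h1 := hsum.mapL (lp.evalCLM ℂ (fun _ : Γ => ℂ) 2 γ)
    have h3 : HasSum (fun σ : A => f γ σ * x σ) (z γ) := by
      have e : ∀ σ : A, f γ σ * x σ = lp.evalCLM ℂ (fun _ : Γ => ℂ) 2 γ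
          (LinearIsometry.toSpanSingleton ℂ _ (hv.1 σ) (y σ)) := fun σ => mul_comm _ _
      simp_rw [e]
      exact h1
    refine (Subtype.val_injective.hasSum_iff (f := fun σ => f γ σ * x σ) ?_).1 h3
    intro σ hσ
    rw [hx σ (by simpa using hσ), mul_zero]
  refine ⟨fun γ => (hcoord γ).summable, ?_⟩
  have h5 := lp.hasSum_norm h2 z
  have h6 := lp.hasSum_norm h2 y
  rw [hz, LinearIsometry.norm_map, ← hz] at h5
  have h7 : HasSum (fun σ => ‖x σ‖ ^ 2) (‖y‖ ^ 2) := by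
    have h8 : HasSum (fun σ : A => ‖x σ‖ ^ 2) (‖y‖ ^ 2) := by simpa using h6
    refine (Subtype.val_injective.hasSum_iff (f := fun σ => ‖x σ‖ ^ 2) ?_).1 h8
    exact fun σ hσ => by rw [hx σ (by simpa using hσ)]; simp
  rw [h7.tsum_eq]
  simp_rw [fun γ => (hcoord γ).tsum_eq]
  simpa using h5

/-! ### Integration over the state space -/

variable {ι : Type*} [MeasurableSpace ι]

theorem measurable_component {S : ι → Set ℝ} (hS : ∀ σ, MeasurableSet (S σ)) (ψ : StateSpace S)
    (σ : ι) : Measurable (component S ψ σ) :=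
  ((Lp.stronglyMeasurable ψ).measurable.comp measurable_prodMk_left).indicator (hS σ)

variable [Countable ι] [DiscreteMeasurableSpace ι]

theorem measurableSet_spectrum {S : ι → Set ℝ} (hS : ∀ σ, MeasurableSet (S σ)) :
    MeasurableSet {p : ι × ℝ | p.2 ∈ S p.1} := by
  have : {p : ι × ℝ | p.2 ∈ S p.1} = ⋃ σ, {σ} ×ˢ S σ := by
    ext p
    simp
  rw [this]
  exact MeasurableSet.iUnion fun σ => (measurableSet_singleton σ).prod (hS σ)

theorem ae_component_of_ae_stateMeasure {S : ι → Set ℝ} (hS : ∀ σ, MeasurableSet (S σ))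
    {q : ι × ℝ → Prop} (h : ∀ᵐ p ∂stateMeasure S, q p) :
    ∀ᵐ E : ℝ, ∀ σ, E ∈ S σ → q (σ, E) := by
  rw [stateMeasure, ae_restrict_iff' (measurableSet_spectrum hS)] at h
  have h1 := Measure.ae_ae_of_ae_prod h
  rw [Measure.ae_count_iff] at h1
  exact ae_all_iff.2 h1

theorem lintegral_stateMeasure {S : ι → Set ℝ} (hS : ∀ σ, MeasurableSet (S σ))
    {g : ι × ℝ → ℝ≥0∞} (hg : Measurable g) :
    ∫⁻ p, g p ∂stateMeasure S = ∫⁻ E, ∑' σ, (S σ).indicator (fun E => g (σ, E)) E := by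
  rw [stateMeasure, ← lintegral_indicator (measurableSet_spectrum hS),
    lintegral_prod_symm _ (hg.indicator (measurableSet_spectrum hS)).aemeasurable]
  refine lintegral_congr fun E => ?_
  rw [lintegral_count]
  rfl

theorem enorm_sq_eq_lintegral {α : Type*} [MeasurableSpace α] {μ : Measure α} (φ : Lp ℂ 2 μ) :
    ‖φ‖ₑ ^ 2 = ∫⁻ x, ‖φ x‖ₑ ^ 2 ∂μ := by
  rw [Lp.enorm_def, lintegral_sq_eq]

theorem enorm_sq_stateSpace {S : ι → Set ℝ} (hS : ∀ σ, MeasurableSet (S σ)) (ψ : StateSpace S) :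
    ‖ψ‖ₑ ^ 2 = ∫⁻ E, ∑' σ, ‖component S ψ σ E‖ₑ ^ 2 := by
  rw [enorm_sq_eq_lintegral,
    lintegral_stateMeasure hS ((Lp.stronglyMeasurable ψ).measurable.enorm.pow_const 2)]
  refine lintegral_congr fun E => tsum_congr fun σ => ?_
  by_cases h : E ∈ S σ <;> simp [component, h]

theorem tsum_enorm_sq_eq {Γ : Type*} {a : Γ → ℂ} (h : Summable fun γ => ‖a γ‖ ^ 2) :
    ∑' γ, ‖a γ‖ₑ ^ 2 = ENNReal.ofReal (∑' γ, ‖a γ‖ ^ 2) := by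
  rw [ENNReal.ofReal_tsum_of_nonneg (fun _ => by positivity) h]
  refine tsum_congr fun γ => ?_
  rw [← ofReal_norm, ENNReal.ofReal_pow (norm_nonneg _)]

theorem summable_norm_sq_iff {Γ : Type*} {a : Γ → ℂ} :
    (Summable fun γ => ‖a γ‖ ^ 2) ↔ ∑' γ, ‖a γ‖ₑ ^ 2 ≠ ⊤ := by
  refine ⟨fun h => by rw [tsum_enorm_sq_eq h]; exact ENNReal.ofReal_ne_top, fun h => ?_⟩
  have := ENNReal.summable_toReal h
  refine this.congr fun γ => ?_
  simp

theorem ae_summable_component {S : ι → Set ℝ} (hS : ∀ σ, MeasurableSet (S σ)) (ψ : StateSpace S) :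
    ∀ᵐ E, Summable fun σ => ‖component S ψ σ E‖ ^ 2 := by
  have h : ∫⁻ E, ∑' σ, ‖component S ψ σ E‖ₑ ^ 2 ≠ ⊤ := by
    rw [← enorm_sq_stateSpace hS]
    simp
  filter_upwards [ae_lt_top (Measurable.tsum fun σ =>
    (measurable_component hS ψ σ).enorm.pow_const 2) h] with E hE
  exact summable_norm_sq_iff.2 hE.ne

/-! ### Amplitudes -/

section Amplitude

variable {S : ι → Set ℝ} {Γ : Type*} {F : Γ → ι → ℝ → ℂ}

/-- At fixed `E` only the columns with `E ∈ S σ` matter, since the other components vanish.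
Countability of the index set merges the exceptional null sets of all pairs. -/
theorem IsIsometricKernel.ae_hasSum (hF : IsIsometricKernel S F)
    (hS : ∀ σ, MeasurableSet (S σ)) (ψ : StateSpace S) :
    ∀ᵐ E, (∀ γ, Summable fun σ => F γ σ E * component S ψ σ E) ∧
      HasSum (fun γ => ‖energyAmplitude S F ψ γ E‖ ^ 2) (∑' σ, ‖component S ψ σ E‖ ^ 2) := by
  classical
  have h1 : ∀ᵐ E, ∀ σ σ', E ∈ S σ → E ∈ S σ' →
      HasSum (fun γ => starRingEnd ℂ (F γ σ E) * F γ σ' E) (if σ = σ' then 1 else 0) :=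
    ae_all_iff.2 fun σ => ae_all_iff.2 fun σ' => by convert! hF.orthonormal σ σ'
  filter_upwards [h1, ae_summable_component hS ψ] with E h2 h3
  exact hasSum_norm_sq_of_orthonormal_columns {σ | E ∈ S σ} (fun γ σ => F γ σ E)
    (fun σ hσ σ' hσ' => h2 σ σ' hσ hσ') (fun σ => component S ψ σ E)
    (fun σ hσ => Set.indicator_of_notMem (s := S σ) hσ _) h3

omit [DiscreteMeasurableSpace ι] in
theorem aemeasurable_energyAmplitude (hm : ∀ γ σ, Measurable (F γ σ))
    (hS : ∀ σ, MeasurableSet (S σ)) (ψ : StateSpace S) (γ : Γ)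
    (h : ∀ᵐ E, Summable fun σ => F γ σ E * component S ψ σ E) :
    AEMeasurable (energyAmplitude S F ψ γ) := by
  refine aemeasurable_of_tendsto_metrizable_ae (ι := Finset ι) atTop
    (f := fun s E => ∑ σ ∈ s, F γ σ E * component S ψ σ E) (fun s => ?_) ?_
  · exact (Finset.measurable_fun_sum s fun σ _ =>
      (hm γ σ).mul (measurable_component hS ψ σ)).aemeasurable
  · filter_upwards [h] with E hE
    exact hE.hasSum

namespace IsIsometricKernel

theorem aemeasurable_energyAmplitude (hF : IsIsometricKernel S F)
    (hS : ∀ σ, MeasurableSet (S σ)) (ψ : StateSpace S) (γ : Γ) :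
    AEMeasurable (energyAmplitude S F ψ γ) := by
  refine TimePOVM.aemeasurable_energyAmplitude hF.measurable hS ψ γ ?_
  filter_upwards [hF.ae_hasSum hS ψ] with E hE
  exact hE.1 γ

theorem tsum_lintegral_energyAmplitude [Countable Γ] (hF : IsIsometricKernel S F)
    (hS : ∀ σ, MeasurableSet (S σ)) (ψ : StateSpace S) :
    ∑' γ, ∫⁻ E, ‖energyAmplitude S F ψ γ E‖ₑ ^ 2 = ‖ψ‖ₑ ^ 2 := by
  rw [← lintegral_tsum fun γ => (hF.aemeasurable_energyAmplitude hS ψ γ).enorm.pow_const 2,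
    enorm_sq_stateSpace hS]
  refine lintegral_congr_ae ?_
  filter_upwards [hF.ae_hasSum hS ψ, ae_summable_component hS ψ] with E hE hE'
  rw [tsum_enorm_sq_eq hE.2.summable, tsum_enorm_sq_eq hE', hE.2.tsum_eq]

theorem lintegral_energyAmplitude_le [Countable Γ] (hF : IsIsometricKernel S F)
    (hS : ∀ σ, MeasurableSet (S σ)) (ψ : StateSpace S) (γ : Γ) :
    ∫⁻ E, ‖energyAmplitude S F ψ γ E‖ₑ ^ 2 ≤ ‖ψ‖ₑ ^ 2 := by
  rw [← hF.tsum_lintegral_energyAmplitude hS ψ]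
  exact ENNReal.le_tsum γ

theorem memLp_energyAmplitude [Countable Γ] (hF : IsIsometricKernel S F)
    (hS : ∀ σ, MeasurableSet (S σ)) (ψ : StateSpace S) (γ : Γ) :
    MemLp (energyAmplitude S F ψ γ) 2 volume := by
  rw [memLp_two_iff (hF.aemeasurable_energyAmplitude hS ψ γ).aestronglyMeasurable]
  exact (hF.lintegral_energyAmplitude_le hS ψ γ).trans_lt (by simp)

theorem energyAmplitude_add (hF : IsIsometricKernel S F)
    (hS : ∀ σ, MeasurableSet (S σ)) (ψ φ : StateSpace S) (γ : Γ) :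
    energyAmplitude S F (ψ + φ) γ
      =ᵐ[volume] energyAmplitude S F ψ γ + energyAmplitude S F φ γ := by
  filter_upwards [hF.ae_hasSum hS ψ, hF.ae_hasSum hS φ,
    ae_component_of_ae_stateMeasure hS (Lp.coeFn_add ψ φ)] with E h1 h2 h3
  rw [Pi.add_apply, energyAmplitude, energyAmplitude, energyAmplitude,
    ← (h1.1 γ).tsum_add (h2.1 γ)]
  refine tsum_congr fun σ => ?_
  rw [← mul_add]
  congr 1
  by_cases h : E ∈ S σ
  · simpa [component, h] using h3 σ h
  · simp [component, h]

theorem energyAmplitude_smul (hS : ∀ σ, MeasurableSet (S σ)) (c : ℂ) (ψ : StateSpace S) (γ : Γ) :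
    energyAmplitude S F (c • ψ) γ =ᵐ[volume] c • energyAmplitude S F ψ γ := by
  filter_upwards [ae_component_of_ae_stateMeasure hS (Lp.coeFn_smul c ψ)] with E h3
  rw [Pi.smul_apply, energyAmplitude, energyAmplitude, smul_eq_mul, ← tsum_mul_left]
  refine tsum_congr fun σ => ?_
  rw [mul_left_comm]
  congr 1
  by_cases h : E ∈ S σ
  · simpa [component, h] using h3 σ h
  · simp [component, h]

/-- The map `ψ ↦ ∑_σ F_{γσ} ψ_σ` as a bounded operator. -/
def amplitudeCLM [Countable Γ] (hF : IsIsometricKernel S F) (hS : ∀ σ, MeasurableSet (S σ))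
    (γ : Γ) : StateSpace S →L[ℂ] Lp ℂ 2 (volume : Measure ℝ) :=
  LinearMap.mkContinuous
    { toFun := fun ψ => (hF.memLp_energyAmplitude hS ψ γ).toLp
      map_add' := fun ψ φ => by
        rw [← MemLp.toLp_add]
        exact MemLp.toLp_congr _ _ (hF.energyAmplitude_add hS ψ φ γ)
      map_smul' := fun c ψ => by
        rw [RingHom.id_apply, ← MemLp.toLp_const_smul]
        exact MemLp.toLp_congr _ _ (energyAmplitude_smul hS c ψ γ) }
    1 (fun ψ => by
      rw [one_mul]
      have h : ‖(hF.memLp_energyAmplitude hS ψ γ).toLp‖ₑ ^ 2 ≤ ‖ψ‖ₑ ^ 2 := by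
        rw [Lp.enorm_toLp, ← lintegral_sq_eq]
        exact hF.lintegral_energyAmplitude_le hS ψ γ
      have h' := (ENNReal.pow_le_pow_left_iff two_ne_zero).1 h
      rwa [← ofReal_norm, ← ofReal_norm, ENNReal.ofReal_le_ofReal_iff (norm_nonneg _)] at h')

theorem amplitudeCLM_apply [Countable Γ] (hF : IsIsometricKernel S F)
    (hS : ∀ σ, MeasurableSet (S σ)) (γ : Γ) (ψ : StateSpace S) :
    hF.amplitudeCLM hS γ ψ = (hF.memLp_energyAmplitude hS ψ γ).toLp := rfl

/-- The density `ρ(ψ, t)` with values in `[0, ∞]`. -/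
def densityFun [Countable Γ] (hF : IsIsometricKernel S F) (hS : ∀ σ, MeasurableSet (S σ))
    (ψ : StateSpace S) (t : ℝ) : ℝ≥0∞ :=
  ∑' γ, ‖timeLp (hF.amplitudeCLM hS γ ψ) t‖ₑ ^ 2

theorem aemeasurable_densityFun [Countable Γ] (hF : IsIsometricKernel S F)
    (hS : ∀ σ, MeasurableSet (S σ)) (ψ : StateSpace S) : AEMeasurable (hF.densityFun hS ψ) :=
  AEMeasurable.tsum fun _ => ((memLp_timeLp _).1.aemeasurable.enorm).pow_const 2

theorem setLIntegral_densityFun [Countable Γ] (hF : IsIsometricKernel S F)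
    (hS : ∀ σ, MeasurableSet (S σ)) (ψ : StateSpace S) (I : Set ℝ) :
    ∫⁻ t in I, hF.densityFun hS ψ t
      = ∑' γ, ∫⁻ t in I, ‖timeLp (hF.amplitudeCLM hS γ ψ) t‖ₑ ^ 2 :=
  lintegral_tsum fun _ => ((memLp_timeLp _).1.aemeasurable.enorm).pow_const 2 |>.restrict

theorem lintegral_densityFun [Countable Γ] (hF : IsIsometricKernel S F)
    (hS : ∀ σ, MeasurableSet (S σ)) (ψ : StateSpace S) :
    ∫⁻ t, hF.densityFun hS ψ t = ‖ψ‖ₑ ^ 2 := by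
  have h := hF.setLIntegral_densityFun hS ψ Set.univ
  rw [Measure.restrict_univ] at h
  rw [h, ← hF.tsum_lintegral_energyAmplitude hS ψ]
  refine tsum_congr fun γ => ?_
  rw [lintegral_timeLp]
  refine lintegral_congr_ae ?_
  filter_upwards [(hF.memLp_energyAmplitude hS ψ γ).coeFn_toLp] with E hE
  rw [amplitudeCLM_apply, hE]

theorem setLIntegral_densityFun_ne_top [Countable Γ] (hF : IsIsometricKernel S F)
    (hS : ∀ σ, MeasurableSet (S σ)) (ψ : StateSpace S) (I : Set ℝ) :
    ∫⁻ t in I, hF.densityFun hS ψ t ≠ ⊤ := by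
  refine ne_top_of_le_ne_top ?_ (setLIntegral_le_lintegral I _)
  rw [lintegral_densityFun]
  simp

theorem densityFun_ae_eq [Countable Γ] (hF : IsIsometricKernel S F)
    (hS : ∀ σ, MeasurableSet (S σ)) (ψ : StateSpace S) {Ψ : Γ → ℝ → ℂ}
    (hΨ : ∀ γ, IsFourierOf (energyAmplitude S F ψ γ) (Ψ γ)) :
    ∀ᵐ t, (Summable fun γ => ‖Ψ γ t‖ ^ 2) ∧
      hF.densityFun hS ψ t = ENNReal.ofReal (∑' γ, ‖Ψ γ t‖ ^ 2) := by
  have h1 : ∀ᵐ t, ∀ γ, Ψ γ t = timeLp (hF.amplitudeCLM hS γ ψ) t :=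
    ae_all_iff.2 fun γ => (hΨ γ).ae_eq_timeLp
  have h2 := ae_lt_top' (hF.aemeasurable_densityFun hS ψ)
    (by rw [lintegral_densityFun]; simp)
  filter_upwards [h1, h2] with t h3 h4
  have h5 : hF.densityFun hS ψ t = ∑' γ, ‖Ψ γ t‖ₑ ^ 2 := tsum_congr fun γ => by rw [h3]
  have h6 : Summable fun γ => ‖Ψ γ t‖ ^ 2 := summable_norm_sq_iff.2 (by rw [← h5]; exact h4.ne)
  exact ⟨h6, by rw [h5, tsum_enorm_sq_eq h6]⟩

theorem setIntegral_density [Countable Γ] (hF : IsIsometricKernel S F)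
    (hS : ∀ σ, MeasurableSet (S σ)) (ψ : StateSpace S) {Ψ : Γ → ℝ → ℂ}
    (hΨ : ∀ γ, IsFourierOf (energyAmplitude S F ψ γ) (Ψ γ)) (I : Set ℝ) :
    ∫ t in I, ∑' γ, ‖Ψ γ t‖ ^ 2 = (∫⁻ t in I, hF.densityFun hS ψ t).toReal := by
  rw [← integral_toReal (hF.aemeasurable_densityFun hS ψ).restrict]
  · refine integral_congr_ae (ae_restrict_of_ae ?_)
    filter_upwards [hF.densityFun_ae_eq hS ψ hΨ] with t ht
    rw [ht.2, ENNReal.toReal_ofReal (tsum_nonneg fun _ => by positivity)]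
  · refine ae_restrict_of_ae ?_
    filter_upwards [hF.densityFun_ae_eq hS ψ hΨ] with t ht
    rw [ht.2]
    exact ENNReal.ofReal_lt_top

/-- For an isometric kernel, the density property only concerns the quadratic forms of `τ`. -/
theorem hasDensity_iff [Countable Γ] (hF : IsIsometricKernel S F)
    (hS : ∀ σ, MeasurableSet (S σ)) (τ : Set ℝ → StateSpace S →L[ℂ] StateSpace S) :
    HasDensity S τ F ↔ ∀ ψ I, MeasurableSet I →
      inner ℂ ψ (τ I ψ) = ((∫⁻ t in I, hF.densityFun hS ψ t).toReal : ℂ) := by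
  constructor
  · intro h ψ I hI
    obtain ⟨-, Ψ, hΨ, -, -, h4⟩ := h ψ
    rw [h4 I hI, hF.setIntegral_density hS ψ hΨ]
  · intro h ψ
    refine ⟨fun γ => ?_, ?_⟩
    · filter_upwards [hF.ae_hasSum hS ψ] with E hE
      exact hE.1 γ
    choose Ψ hΨ using fun γ => exists_isFourierOf (hF.memLp_energyAmplitude hS ψ γ)
    refine ⟨Ψ, fun γ => (hΨ γ).1, ?_, ?_, fun I hI => ?_⟩
    · filter_upwards [hF.densityFun_ae_eq hS ψ fun γ => (hΨ γ).1] with t ht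
      exact ht.1
    · refine (integrable_toReal_of_lintegral_ne_top (hF.aemeasurable_densityFun hS ψ)
        (by rw [lintegral_densityFun]; simp)).congr ?_
      filter_upwards [hF.densityFun_ae_eq hS ψ fun γ => (hΨ γ).1] with t ht
      rw [ht.2, ENNReal.toReal_ofReal (tsum_nonneg fun _ => by positivity)]
    · rw [h ψ I hI, hF.setIntegral_density hS ψ fun γ => (hΨ γ).1]

end IsIsometricKernel

end Amplitude

end

section

/-! ### Quadratic forms -/

section Hilbert

variable {H : Type*} [NormedAddCommGroup H] [InnerProductSpace ℂ H]

theorem inner_map_polarization_right (A : H →L[ℂ] H) (φ ψ : H) :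
    inner ℂ φ (A ψ) = (inner ℂ (φ + ψ) (A (φ + ψ)) - inner ℂ (φ - ψ) (A (φ - ψ))
      - Complex.I * inner ℂ (φ + Complex.I • ψ) (A (φ + Complex.I • ψ))
      + Complex.I * inner ℂ (φ - Complex.I • ψ) (A (φ - Complex.I • ψ))) / 4 := by
  simp only [map_add, map_sub, map_smul, inner_add_left, inner_add_right, inner_sub_left,
    inner_sub_right, inner_smul_left, inner_smul_right, Complex.conj_I]
  ring_nf
  simp only [Complex.I_sq]
  ring

theorem clm_ext_of_inner_self {A B : H →L[ℂ] H} (h : ∀ ψ, inner ℂ ψ (A ψ) = inner ℂ ψ (B ψ)) :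
    A = B := by
  refine ContinuousLinearMap.ext fun ψ => ext_inner_left ℂ fun φ => ?_
  rw [inner_map_polarization_right A, inner_map_polarization_right B, h, h, h, h]

variable [CompleteSpace H]

/-- A square summable family of bounded operators defines a positive quadratic form, which is
that of a bounded operator. -/
theorem exists_clm_inner_eq_tsum {Γ : Type*} {K : Γ → Type*} [∀ γ, NormedAddCommGroup (K γ)]
    [∀ γ, InnerProductSpace ℂ (K γ)] [∀ γ, CompleteSpace (K γ)] (T : ∀ γ, H →L[ℂ] K γ)
    (hs : ∀ ψ, Summable fun γ => ‖T γ ψ‖ ^ 2) (hb : ∀ ψ, ∑' γ, ‖T γ ψ‖ ^ 2 ≤ ‖ψ‖ ^ 2) :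
    ∃ A : H →L[ℂ] H, ∀ ψ, inner ℂ ψ (A ψ) = ((∑' γ, ‖T γ ψ‖ ^ 2 : ℝ) : ℂ) := by
  have h2 : (0 : ℝ) < (2 : ℝ≥0∞).toReal := by simp
  have hm : ∀ ψ, Memℓp (fun γ => T γ ψ) 2 := fun ψ => by
    rw [memℓp_gen_iff h2]
    simpa using hs ψ
  let V₀ : H →ₗ[ℂ] lp K 2 :=
    { toFun := fun ψ => ⟨fun γ => T γ ψ, hm ψ⟩
      map_add' := fun ψ φ => by
        ext γ
        exact map_add (T γ) ψ φ
      map_smul' := fun c ψ => by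
        ext γ
        exact map_smul (T γ) c ψ }
  have hn : ∀ ψ, ‖V₀ ψ‖ ^ 2 = ∑' γ, ‖T γ ψ‖ ^ 2 := fun ψ => by
    have h := lp.norm_rpow_eq_tsum h2 (V₀ ψ)
    simp only [ENNReal.toReal_ofNat, Real.rpow_ofNat] at h
    exact h
  let V : H →L[ℂ] lp K 2 := V₀.mkContinuous 1 fun ψ => by
    rw [one_mul]
    refine (pow_le_pow_iff_left₀ (norm_nonneg _) (norm_nonneg _) two_ne_zero).1 ?_
    rw [hn]
    exact hb ψ
  refine ⟨ContinuousLinearMap.adjoint V ∘L V, fun ψ => ?_⟩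
  rw [ContinuousLinearMap.comp_apply, ContinuousLinearMap.adjoint_inner_right,
    inner_self_eq_norm_sq_to_K, ← hn]
  push_cast
  rfl

end Hilbert

/-! ### The measure of a kernel -/

variable {ι : Type*} [MeasurableSpace ι] [Countable ι] [DiscreteMeasurableSpace ι]
  {S : ι → Set ℝ} {Γ : Type*} [Countable Γ] {F : Γ → ι → ℝ → ℂ}

omit [Countable ι] [DiscreteMeasurableSpace ι] in
theorem timeTranslation_ae (s : ℝ) (ψ : StateSpace S) :
    timeTranslation S s ψ =ᵐ[stateMeasure S] fun p => phase s p * ψ p :=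
  MemLp.coeFn_toLp (memLp_phase_mul S s ψ)

namespace IsIsometricKernel

theorem exists_hasDensity (hF : IsIsometricKernel S F) (hS : ∀ σ, MeasurableSet (S σ)) :
    ∃ τ : Set ℝ → StateSpace S →L[ℂ] StateSpace S, HasDensity S τ F := by
  have key : ∀ I : Set ℝ, ∃ A : StateSpace S →L[ℂ] StateSpace S,
      ∀ ψ, inner ℂ ψ (A ψ) = ((∫⁻ t in I, hF.densityFun hS ψ t).toReal : ℂ) := by
    intro I
    -- `J` is the set `I` of times expressed in frequencies. Restricting the unscaled transform to
    -- `J` gives bounded operators with `∑_γ ‖T γ ψ‖² = ∫_I ρ(ψ, t) dt`.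
    set J : Set ℝ := (fun t : ℝ => t * (2 * Real.pi)) ⁻¹' I with hJ
    have hIJ : (fun t : ℝ => t / (2 * Real.pi)) ⁻¹' J = I := by
      ext t
      have : t / (2 * Real.pi) * (2 * Real.pi) = t := div_mul_cancel₀ _ (by positivity)
      simp [hJ, this]
    let T : Γ → StateSpace S →L[ℂ] Lp ℂ 2 ((volume : Measure ℝ).restrict J) := fun γ =>
      (LpToLpRestrictCLM ℝ ℂ ℂ volume 2 J) ∘L
        (Lp.fourierTransformₗᵢ ℝ ℂ).toContinuousLinearEquiv.toContinuousLinearMap ∘L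
          hF.amplitudeCLM hS γ
    have hT : ∀ γ ψ, ‖T γ ψ‖ₑ ^ 2 = ∫⁻ t in I, ‖timeLp (hF.amplitudeCLM hS γ ψ) t‖ₑ ^ 2 := by
      intro γ ψ
      rw [enorm_sq_eq_lintegral]
      have h1 := LpToLpRestrictCLM_coeFn ℂ J
        (𝓕 (hF.amplitudeCLM hS γ ψ) : Lp ℂ 2 (volume : Measure ℝ))
      calc ∫⁻ t in J, ‖T γ ψ t‖ₑ ^ 2
          = ∫⁻ t in J, ‖(𝓕 (hF.amplitudeCLM hS γ ψ) : Lp ℂ 2 (volume : Measure ℝ)) t‖ₑ ^ 2 :=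
            lintegral_congr_ae (h1.mono fun t ht => congrArg (fun z => ‖z‖ₑ ^ 2) ht)
        _ = _ := by rw [← setLIntegral_rescale, hIJ, timeLp]
    have hsum : ∀ ψ, ∑' γ, ‖T γ ψ‖ₑ ^ 2 = ∫⁻ t in I, hF.densityFun hS ψ t := fun ψ => by
      rw [setLIntegral_densityFun]
      exact tsum_congr fun γ => hT γ ψ
    have htop : ∀ ψ, ∑' γ, ‖T γ ψ‖ₑ ^ 2 ≠ ⊤ := fun ψ => by
      rw [hsum]
      exact hF.setLIntegral_densityFun_ne_top hS ψ I
    have hreal : ∀ ψ, ∑' γ, ‖T γ ψ‖ ^ 2 = (∫⁻ t in I, hF.densityFun hS ψ t).toReal := fun ψ => by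
      rw [← hsum, ENNReal.tsum_toReal_eq (ENNReal.ne_top_of_tsum_ne_top (htop ψ))]
      simp
    obtain ⟨A, hA⟩ := exists_clm_inner_eq_tsum T
      (fun ψ => (ENNReal.summable_toReal (htop ψ)).congr fun γ => by simp)
      (fun ψ => by
        rw [hreal]
        refine ENNReal.toReal_le_of_le_ofReal (by positivity) ?_
        refine (setLIntegral_le_lintegral I _).trans ?_
        rw [lintegral_densityFun, ← ofReal_norm, ENNReal.ofReal_pow (norm_nonneg _)])
    exact ⟨A, fun ψ => by rw [hA, hreal]⟩
  choose A hA using key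
  exact ⟨A, (hF.hasDensity_iff hS A).2 fun ψ I _ => hA I ψ⟩

theorem isNormalizedPOVM (hF : IsIsometricKernel S F) (hS : ∀ σ, MeasurableSet (S σ))
    {τ : Set ℝ → StateSpace S →L[ℂ] StateSpace S} (h : HasDensity S τ F) :
    IsNormalizedPOVM τ := by
  rw [hF.hasDensity_iff hS] at h
  refine ⟨fun I hI => ?_, ?_, fun I hI hd φ ψ => ?_, ?_⟩
  · rw [ContinuousLinearMap.isPositive_iff_complex]
    intro ψ
    have h1 : inner ℂ (τ I ψ) ψ = ((∫⁻ t in I, hF.densityFun hS ψ t).toReal : ℂ) := by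
      rw [← inner_conj_symm, h ψ I hI, Complex.conj_ofReal]
    rw [h1]
    simp
  · refine clm_ext_of_inner_self fun ψ => ?_
    rw [h ψ ∅ MeasurableSet.empty]
    simp
  · have key : ∀ ψ, HasSum (fun n => inner ℂ ψ (τ (I n) ψ)) (inner ℂ ψ (τ (⋃ n, I n) ψ)) := by
      intro ψ
      rw [h ψ _ (MeasurableSet.iUnion hI)]
      simp_rw [fun n => h ψ _ (hI n)]
      rw [Complex.hasSum_ofReal, lintegral_iUnion hI hd]
      have hne : ∑' n, ∫⁻ t in I n, hF.densityFun hS ψ t ≠ ⊤ := by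
        rw [← lintegral_iUnion hI hd]
        exact hF.setLIntegral_densityFun_ne_top hS ψ _
      rw [ENNReal.tsum_toReal_eq (ENNReal.ne_top_of_tsum_ne_top hne)]
      exact (ENNReal.summable_toReal hne).hasSum
    -- Additivity off the diagonal is a linear combination of four diagonal cases.
    simp_rw [inner_map_polarization_right (τ _) φ ψ]
    exact ((((key _).sub (key _)).sub ((key _).mul_left _)).add ((key _).mul_left _)).div_const 4
  · refine clm_ext_of_inner_self fun ψ => ?_
    rw [h ψ _ MeasurableSet.univ, Measure.restrict_univ, lintegral_densityFun,
      one_apply_eq_self, inner_self_eq_norm_sq_to_K]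
    simp

omit [Countable Γ] in
theorem energyAmplitude_timeTranslation (hS : ∀ σ, MeasurableSet (S σ)) (s : ℝ)
    (ψ : StateSpace S) (γ : Γ) :
    energyAmplitude S F (timeTranslation S s ψ) γ
      =ᵐ[volume] fun E => Complex.exp (Complex.I * s * E) * energyAmplitude S F ψ γ E := by
  filter_upwards [ae_component_of_ae_stateMeasure hS (timeTranslation_ae s ψ)] with E h3
  rw [energyAmplitude, energyAmplitude, ← tsum_mul_left]
  refine tsum_congr fun σ => ?_
  rw [mul_left_comm]
  congr 1
  by_cases h : E ∈ S σ
  · simpa [component, h, phase] using h3 σ h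
  · simp [component, h]

theorem densityFun_timeTranslation (hF : IsIsometricKernel S F) (hS : ∀ σ, MeasurableSet (S σ))
    (s : ℝ) (ψ : StateSpace S) :
    ∀ᵐ t, hF.densityFun hS (timeTranslation S s ψ) t = hF.densityFun hS ψ (t - s) := by
  have h : ∀ γ, ∀ᵐ t, timeLp (hF.amplitudeCLM hS γ (timeTranslation S s ψ)) t
      = timeLp (hF.amplitudeCLM hS γ ψ) (t - s) := by
    intro γ
    obtain ⟨Ψ, h1, h2⟩ := exists_isFourierOf (hF.memLp_energyAmplitude hS ψ γ)
    obtain ⟨Ψ', h1', h2'⟩ :=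
      exists_isFourierOf (hF.memLp_energyAmplitude hS (timeTranslation S s ψ) γ)
    have h3 := h1'.unique (energyAmplitude_timeTranslation hS s ψ γ) (h1.shift s)
    have h4 := (measurePreserving_sub_right (volume : Measure ℝ) s).quasiMeasurePreserving.ae h2
    filter_upwards [h3, h4, h2'] with t h5 h6 h7
    rw [amplitudeCLM_apply, amplitudeCLM_apply, ← h7, h5, h6]
  filter_upwards [ae_all_iff.2 h] with t ht
  exact tsum_congr fun γ => by rw [ht]

theorem isCovariant (hF : IsIsometricKernel S F) (hS : ∀ σ, MeasurableSet (S σ))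
    {τ : Set ℝ → StateSpace S →L[ℂ] StateSpace S} (h : HasDensity S τ F) :
    IsCovariant S τ := by
  rw [hF.hasDensity_iff hS] at h
  intro s I hI
  have himg : (fun t => t + s) '' I = (fun t => t - s) ⁻¹' I := by
    simp [Set.image_add_right, sub_eq_add_neg]
  refine clm_ext_of_inner_self fun ψ => ?_
  rw [ContinuousLinearMap.comp_apply, ContinuousLinearMap.comp_apply,
    ContinuousLinearMap.adjoint_inner_right, himg, h _ _ (measurable_sub_const s hI), h ψ I hI]
  congr 2
  rw [lintegral_congr_ae (ae_restrict_of_ae (hF.densityFun_timeTranslation hS s ψ))]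
  exact (measurePreserving_sub_right (volume : Measure ℝ) s).setLIntegral_comp_preimage_emb
    (Homeomorph.subRight s).measurableEmbedding _ _

end IsIsometricKernel

end

section

/-! ### Positive operators and their limits -/

section Hilbert

variable {H : Type*} [NormedAddCommGroup H] [InnerProductSpace ℂ H] [CompleteSpace H]

theorem exists_sqrt_of_isPositive {A : H →L[ℂ] H} (hA : A.IsPositive) :
    ∃ B : H →L[ℂ] H, ∀ φ ψ, inner ℂ φ (A ψ) = inner ℂ (B φ) (B ψ) := by
  obtain ⟨B, hB⟩ := CStarAlgebra.nonneg_iff_eq_star_mul_self.1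
    ((ContinuousLinearMap.nonneg_iff_isPositive A).2 hA)
  refine ⟨B, fun φ ψ => ?_⟩
  rw [hB, ContinuousLinearMap.star_eq_adjoint, mul_apply_eq_comp,
    ContinuousLinearMap.adjoint_inner_right]

omit [CompleteSpace H] in
theorem inner_self_eq_norm_sq_complex (ψ : H) : inner ℂ ψ ψ = ((‖ψ‖ ^ 2 : ℝ) : ℂ) := by
  rw [inner_self_eq_norm_sq_to_K]
  push_cast
  rfl

/-- A bounded family of operators converges weakly along every ultrafilter. -/
theorem exists_weak_limit {α : Type*} (l : Ultrafilter α) (A : α → H →L[ℂ] H)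
    (hA : ∀ n φ ψ, ‖inner ℂ (A n φ) ψ‖ ≤ ‖φ‖ * ‖ψ‖) :
    ∃ N : H →L[ℂ] H, ∀ φ ψ, Tendsto (fun n => inner ℂ (A n φ) ψ) l (𝓝 (inner ℂ (N φ) ψ)) := by
  -- Compactness of a closed disc gives the scalar limits. They inherit sesquilinearity and the
  -- bound, so the limit form is represented by an operator.
  have hlim : ∀ φ ψ, ∃ z : ℂ, ‖z‖ ≤ ‖φ‖ * ‖ψ‖ ∧
      Tendsto (fun n => inner ℂ (A n φ) ψ) l (𝓝 z) := by
    intro φ ψ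
    obtain ⟨z, hz, hz'⟩ := isCompact_iff_ultrafilter_le_nhds'.1
      (isCompact_closedBall (0 : ℂ) (‖φ‖ * ‖ψ‖)) (l.map fun n => inner ℂ (A n φ) ψ)
      (by
        rw [Ultrafilter.mem_map]
        exact univ_mem' fun n => by simpa using hA n φ ψ)
    exact ⟨z, by simpa using hz, hz'⟩
  choose L hL hT using hlim
  let B₀ : H →ₗ⋆[ℂ] H →ₗ[ℂ] ℂ := LinearMap.mk₂'ₛₗ (starRingEnd ℂ) (RingHom.id ℂ) L
    (fun φ φ' ψ => tendsto_nhds_unique (hT _ _) (by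
      simpa only [map_add, inner_add_left] using (hT φ ψ).add (hT φ' ψ)))
    (fun c φ ψ => tendsto_nhds_unique (hT _ _) (by
      simpa only [map_smul, inner_smul_left, smul_eq_mul] using (hT φ ψ).const_mul _))
    (fun φ ψ ψ' => tendsto_nhds_unique (hT _ _) (by
      simpa only [inner_add_right] using (hT φ ψ).add (hT φ ψ')))
    (fun c φ ψ => tendsto_nhds_unique (hT _ _) (by
      simpa only [inner_smul_right, smul_eq_mul, RingHom.id_apply] using (hT φ ψ).const_mul _))
  let B : H →L⋆[ℂ] H →L[ℂ] ℂ := B₀.mkContinuous₂ 1 fun φ ψ => by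
    rw [one_mul]
    exact hL φ ψ
  refine ⟨InnerProductSpace.continuousLinearMapOfBilin B, fun φ ψ => ?_⟩
  rw [InnerProductSpace.continuousLinearMapOfBilin_apply]
  exact hT φ ψ

/-- Cauchy–Schwarz for the factors of `A n` extends the diagonal bound to all matrix elements, so a
weak limit exists; it is again positive and factors as `B†B`. -/
theorem exists_sqrt_weak_limit {α : Type*} (l : Ultrafilter α) (A : α → H →L[ℂ] H)
    (hA : ∀ n, (A n).IsPositive) (hb : ∀ n ψ, (inner ℂ ψ (A n ψ)).re ≤ ‖ψ‖ ^ 2) :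
    ∃ B : H →L[ℂ] H, ∀ ψ, Tendsto (fun n => (inner ℂ ψ (A n ψ)).re) l (𝓝 (‖B ψ‖ ^ 2)) := by
  obtain ⟨N, hN⟩ := exists_weak_limit l A fun n φ ψ => by
    obtain ⟨B, hB⟩ := exists_sqrt_of_isPositive (hA n)
    have hn : ∀ φ, ‖B φ‖ ≤ ‖φ‖ := fun φ => by
      have := hb n φ
      rw [hB, inner_self_eq_norm_sq_complex, Complex.ofReal_re] at this
      exact (pow_le_pow_iff_left₀ (norm_nonneg _) (norm_nonneg _) two_ne_zero).1 this
    rw [(hA n).inner_left_eq_inner_right, hB]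
    exact (norm_inner_le_norm _ _).trans (mul_le_mul (hn _) (hn _) (norm_nonneg _) (norm_nonneg _))
  have hre : ∀ ψ, Tendsto (fun n => (inner ℂ ψ (A n ψ)).re) l (𝓝 (inner ℂ (N ψ) ψ).re) :=
    fun ψ => by
      simpa only [(hA _).inner_left_eq_inner_right, Function.comp_def] using
        (Complex.continuous_re.tendsto _).comp (hN ψ ψ)
  have hpos : N.IsPositive := by
    rw [ContinuousLinearMap.isPositive_iff_complex]
    intro ψ
    have h0 : ∀ n, (inner ℂ (A n ψ) ψ).im = 0 := fun n => by
      have := (ContinuousLinearMap.isPositive_iff_complex _).1 (hA n) ψ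
      rw [← this.1]
      simp
    have him : (inner ℂ (N ψ) ψ).im = 0 := by
      have := (Complex.continuous_im.tendsto _).comp (hN ψ ψ)
      refine tendsto_nhds_unique this ?_
      simp only [Function.comp_def, h0]
      exact tendsto_const_nhds
    refine ⟨Complex.ext (by simp) (by simp [him]), ?_⟩
    exact ge_of_tendsto (hre ψ) (Eventually.of_forall fun n =>
      (hA n).re_inner_nonneg_right ψ)
  obtain ⟨B, hB⟩ := exists_sqrt_of_isPositive hpos
  refine ⟨B, fun ψ => ?_⟩
  have := hre ψ
  rwa [hpos.inner_left_eq_inner_right, hB, inner_self_eq_norm_sq_complex,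
    Complex.ofReal_re] at this

/-- Parseval's identity with a countable family indexed in the lowest universe. -/
theorem exists_countable_parseval [TopologicalSpace.SeparableSpace H] :
    ∃ (Γ : Type) (_ : Countable Γ) (e : Γ → H), ∀ ψ, ∑' γ, ‖inner ℂ (e γ) ψ‖ₑ ^ 2 = ‖ψ‖ₑ ^ 2 := by
  obtain ⟨w, b, hb⟩ := exists_hilbertBasis ℂ H
  have hw : w.Countable := by
    -- Distinct basis vectors are at distance `√2 > 1`, so balls of radius `1/2` about them are
    -- disjoint, and a separable space holds only countably many.
    refine Set.PairwiseDisjoint.countable_of_isOpen (s := fun x => Metric.ball x (1 / 2))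
      (fun x hx y hy hxy => ?_) (fun _ _ => Metric.isOpen_ball)
      fun x _ => ⟨x, Metric.mem_ball_self (by norm_num)⟩
    refine Metric.ball_disjoint_ball ?_
    have ho := b.orthonormal
    rw [hb] at ho
    have h1 : ‖x‖ = 1 := ho.1 ⟨x, hx⟩
    have h2 : ‖y‖ = 1 := ho.1 ⟨y, hy⟩
    have h3 : inner ℂ x y = 0 := ho.2 (i := ⟨x, hx⟩) (j := ⟨y, hy⟩) (by simpa using hxy)
    have h4 := norm_sub_sq (𝕜 := ℂ) x y
    rw [h1, h2, h3] at h4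
    rw [dist_eq_norm]
    norm_num at h4 ⊢
    nlinarith [norm_nonneg (x - y)]
  have := hw.to_subtype
  refine ⟨Shrink.{0} w, (equivShrink.{0} w).symm.injective.countable,
    fun γ => b ((equivShrink.{0} w).symm γ), fun ψ => ?_⟩
  rw [(equivShrink.{0} w).symm.tsum_eq (fun i => ‖inner ℂ (b i) ψ‖ₑ ^ 2)]
  have h := lp.hasSum_norm (by simp) (b.repr ψ)
  simp only [ENNReal.toReal_ofNat, Real.rpow_ofNat, LinearIsometryEquiv.norm_map,
    HilbertBasis.repr_apply_apply] at h
  rw [tsum_enorm_sq_eq h.summable, h.tsum_eq, ← ofReal_norm, ENNReal.ofReal_pow (norm_nonneg _)]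

/-! ### The measure of a state -/

variable {τ : Set ℝ → H →L[ℂ] H}

/-- The measure `I ↦ (ψ, τ(I) ψ)`. -/
def IsNormalizedPOVM.measure (hτ : IsNormalizedPOVM τ) (ψ : H) : Measure ℝ :=
  Measure.ofMeasurable (fun I _ => ENNReal.ofReal (inner ℂ ψ (τ I ψ)).re)
    (by simp [hτ.empty])
    (fun I hI hd => by
      have h := Complex.hasSum_re (hτ.iUnion I hI hd ψ ψ)
      rw [← h.tsum_eq]
      exact ENNReal.ofReal_tsum_of_nonneg (fun n => (hτ.positive _ (hI n)).re_inner_nonneg_right ψ)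
        h.summable)

namespace IsNormalizedPOVM

omit [CompleteSpace H] in
theorem measure_apply (hτ : IsNormalizedPOVM τ) (ψ : H) {I : Set ℝ} (hI : MeasurableSet I) :
    hτ.measure ψ I = ENNReal.ofReal (inner ℂ ψ (τ I ψ)).re :=
  Measure.ofMeasurable_apply I hI

omit [CompleteSpace H] in
theorem inner_eq (hτ : IsNormalizedPOVM τ) (ψ : H) {I : Set ℝ} (hI : MeasurableSet I) :
    inner ℂ ψ (τ I ψ) = ((hτ.measure ψ I).toReal : ℂ) := by
  rw [hτ.measure_apply ψ hI,
    ENNReal.toReal_ofReal (show 0 ≤ (inner ℂ ψ (τ I ψ)).re from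
      (hτ.positive I hI).re_inner_nonneg_right ψ)]
  have := ((ContinuousLinearMap.isPositive_iff_complex _).1 (hτ.positive I hI) ψ).1
  rw [(hτ.positive I hI).inner_left_eq_inner_right] at this
  exact this.symm

omit [CompleteSpace H] in
theorem measure_univ (hτ : IsNormalizedPOVM τ) (ψ : H) :
    hτ.measure ψ Set.univ = ‖ψ‖ₑ ^ 2 := by
  rw [hτ.measure_apply ψ MeasurableSet.univ, hτ.normalized, one_apply_eq_self,
    inner_self_eq_norm_sq_complex, Complex.ofReal_re, ENNReal.ofReal_pow (norm_nonneg _),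
    ofReal_norm]

instance (hτ : IsNormalizedPOVM τ) (ψ : H) : IsFiniteMeasure (hτ.measure ψ) :=
  ⟨by rw [measure_univ]; simp⟩

end IsNormalizedPOVM

end Hilbert

/-! ### Functions of the energy -/

variable {ι : Type*} [MeasurableSpace ι] {S : ι → Set ℝ}

/-- Multiplication by a bounded function of the energy. -/
theorem exists_energyMul (S : ι → Set ℝ) {m : ℝ → ℂ} (hm : Measurable m) (hb : ∀ E, ‖m E‖ ≤ 1) :
    ∃ M : StateSpace S →L[ℂ] StateSpace S,
      ∀ ψ, M ψ =ᵐ[stateMeasure S] fun p => m p.2 * ψ p := by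
  have hmem : ∀ ψ : StateSpace S, MemLp (fun p => m p.2 * ψ p) 2 (stateMeasure S) := fun ψ => by
    refine (Lp.memLp ψ).of_le ((hm.comp measurable_snd).aestronglyMeasurable.mul
      (Lp.aestronglyMeasurable ψ)) (Eventually.of_forall fun p => ?_)
    rw [norm_mul]
    exact mul_le_of_le_one_left (norm_nonneg _) (hb _)
  refine ⟨LinearMap.mkContinuous
    { toFun := fun ψ => (hmem ψ).toLp
      map_add' := fun ψ φ => by
        rw [← MemLp.toLp_add]
        refine MemLp.toLp_congr _ _ ?_
        filter_upwards [Lp.coeFn_add ψ φ] with p h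
        rw [h, Pi.add_apply, Pi.add_apply, mul_add]
      map_smul' := fun c ψ => by
        rw [RingHom.id_apply, ← MemLp.toLp_const_smul]
        refine MemLp.toLp_congr _ _ ?_
        filter_upwards [Lp.coeFn_smul c ψ] with p h
        rw [h, Pi.smul_apply, Pi.smul_apply, smul_eq_mul, smul_eq_mul, mul_left_comm] }
    1 fun ψ => ?_, fun ψ => (hmem ψ).coeFn_toLp⟩
  rw [one_mul]
  refine Lp.norm_le_norm_of_ae_le ?_
  filter_upwards [(hmem ψ).coeFn_toLp] with p h
  rw [LinearMap.coe_mk, AddHom.coe_mk, h, norm_mul]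
  exact mul_le_of_le_one_left (norm_nonneg _) (hb _)

/-- The function `(1 - i E)⁻¹`. -/
def resolventFun (E : ℝ) : ℂ := (1 - Complex.I * E)⁻¹

theorem one_sub_I_mul_ne_zero (E : ℝ) : 1 - Complex.I * E ≠ 0 := fun h => by
  have := congrArg Complex.re h
  simp at this

theorem resolventFun_ne_zero (E : ℝ) : resolventFun E ≠ 0 := inv_ne_zero (one_sub_I_mul_ne_zero E)

theorem measurable_resolventFun : Measurable resolventFun := by
  unfold resolventFun
  fun_prop

theorem norm_resolventFun_le (E : ℝ) : ‖resolventFun E‖ ≤ 1 := by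
  rw [resolventFun, norm_inv]
  refine inv_le_one_of_one_le₀ ?_
  have := Complex.abs_re_le_norm (1 - Complex.I * E)
  simpa using this

/-- The resolvent `(1 - i H)⁻¹` of the energy operator `H`. -/
def resolvent (S : ι → Set ℝ) : StateSpace S →L[ℂ] StateSpace S :=
  (exists_energyMul S measurable_resolventFun norm_resolventFun_le).choose

theorem resolvent_ae (ψ : StateSpace S) :
    resolvent S ψ =ᵐ[stateMeasure S] fun p => resolventFun p.2 * ψ p :=
  (exists_energyMul S measurable_resolventFun norm_resolventFun_le).choose_spec ψ

theorem resolvent_timeTranslation (s : ℝ) (ψ : StateSpace S) :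
    resolvent S (timeTranslation S s ψ) = timeTranslation S s (resolvent S ψ) := by
  apply Lp.ext
  filter_upwards [resolvent_ae (timeTranslation S s ψ), timeTranslation_ae s (resolvent S ψ),
    resolvent_ae ψ, timeTranslation_ae s ψ] with p h1 h2 h3 h4
  rw [h1, h2, h3, h4, mul_left_comm]

/-- The range of the resolvent is dense: the adjoint multiplies by the conjugate of `resolventFun`,
which never vanishes, and is thus injective. -/
theorem eq_zero_of_inner_resolvent {φ : StateSpace S}
    (h : ∀ ψ, inner ℂ φ (resolvent S ψ) = 0) : φ = 0 := by
  obtain ⟨M, hM⟩ := exists_energyMul S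
    (m := fun E => starRingEnd ℂ (resolventFun E))
    (Complex.continuous_conj.measurable.comp measurable_resolventFun)
    (fun E => by rw [RCLike.norm_conj]; exact norm_resolventFun_le E)
  have h1 : inner ℂ (M φ) (M φ) = 0 := by
    rw [← h (M φ), L2.inner_def, L2.inner_def]
    refine integral_congr_ae ?_
    filter_upwards [hM φ, resolvent_ae (M φ)] with p h2 h3
    rw [h3, h2]
    simp only [RCLike.inner_apply, map_mul, Complex.conj_conj]
    ring
  have h2 := inner_self_eq_zero.1 h1
  rw [Lp.eq_zero_iff_ae_eq_zero] at h2 ⊢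
  filter_upwards [h2, hM φ] with p h3 h4
  rw [h3, Pi.zero_apply, eq_comm, mul_eq_zero] at h4
  exact h4.resolve_left (by simpa using resolventFun_ne_zero p.2)

theorem integral_exp_neg_mul_phase (E : ℝ) :
    ∫ s in Set.Ioi (0 : ℝ), (Real.exp (-s) : ℂ) * Complex.exp (Complex.I * s * E)
      = resolventFun E := by
  have h : ∀ s : ℝ, (Real.exp (-s) : ℂ) * Complex.exp (Complex.I * s * E)
      = Complex.exp ((Complex.I * E - 1) * s) := fun s => by
    rw [Complex.ofReal_exp, ← Complex.exp_add]
    congr 1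
    push_cast
    ring
  simp_rw [h]
  rw [integral_exp_mul_complex_Ioi (by simp) 0, resolventFun]
  have h1 := one_sub_I_mul_ne_zero E
  have h2 : Complex.I * E - 1 ≠ 0 := by
    rw [← neg_ne_zero, neg_sub]
    exact h1
  simp only [Complex.ofReal_zero, mul_zero, Complex.exp_zero]
  field_simp
  ring

variable [Countable ι] [DiscreteMeasurableSpace ι]

instance : SigmaFinite (stateMeasure S) := by
  unfold stateMeasure
  infer_instance

/-- The resolvent is the Laplace transform of the time translations. -/
theorem inner_resolvent (φ ψ : StateSpace S) :
    inner ℂ φ (resolvent S ψ)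
      = ∫ s in Set.Ioi (0 : ℝ), (Real.exp (-s) : ℂ) * inner ℂ φ (timeTranslation S s ψ) := by
  have e1 : ∀ s : ℝ, (Real.exp (-s) : ℂ) * inner ℂ φ (timeTranslation S s ψ)
      = ∫ p, (Real.exp (-s) : ℂ) * phase s p * inner ℂ (φ p) (ψ p) ∂stateMeasure S := fun s => by
    rw [L2.inner_def, ← integral_const_mul]
    refine integral_congr_ae ?_
    filter_upwards [timeTranslation_ae s ψ] with p h
    rw [h]
    simp only [RCLike.inner_apply]
    ring
  simp_rw [e1]
  rw [integral_integral_swap]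
  · rw [L2.inner_def]
    refine integral_congr_ae ?_
    filter_upwards [resolvent_ae ψ] with p h
    rw [h, integral_mul_const]
    simp only [phase]
    rw [integral_exp_neg_mul_phase]
    simp only [RCLike.inner_apply]
    ring
  · have h1 : Integrable (fun s : ℝ => (Real.exp (-s) : ℂ)) (volume.restrict (Set.Ioi 0)) :=
      (integrableOn_exp_neg_Ioi 0).ofReal
    have h2 := h1.mul_prod (L2.integrable_inner (𝕜 := ℂ) φ ψ)
    have h3 : Measurable fun z : ℝ × (ι × ℝ) => phase z.1 z.2 := by
      unfold phase
      fun_prop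
    refine (h2.bdd_mul (c := 1) h3.aestronglyMeasurable
      (Eventually.of_forall fun z => (norm_phase _ _).le)).congr (Eventually.of_forall fun z => ?_)
    simp only [Function.uncurry]
    ring

/-! ### Time densities of covariant measures on the range of the resolvent -/

variable {τ : Set ℝ → StateSpace S →L[ℂ] StateSpace S}

omit [Countable ι] [DiscreteMeasurableSpace ι] in
theorem measure_timeTranslation (hτ : IsNormalizedPOVM τ) (hc : IsCovariant S τ) (s : ℝ)
    (ψ : StateSpace S) {I : Set ℝ} (hI : MeasurableSet I) :
    hτ.measure (timeTranslation S s ψ) I = hτ.measure ψ ((fun t => t + s) ⁻¹' I) := by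
  have hJ : MeasurableSet ((fun t => t + s) ⁻¹' I) := measurable_add_const s hI
  have himg : (fun t => t + s) '' ((fun t => t + s) ⁻¹' I) = I :=
    Set.image_preimage_eq _ (add_right_surjective s)
  have h := hc s _ hJ
  rw [himg] at h
  rw [hτ.measure_apply _ hI, hτ.measure_apply _ hJ, ← h, ContinuousLinearMap.comp_apply,
    ContinuousLinearMap.comp_apply, ContinuousLinearMap.adjoint_inner_right]

/-- States in the range of the resolvent have bounded time densities. -/
theorem measure_resolvent_le (hτ : IsNormalizedPOVM τ) (hc : IsCovariant S τ)
    (ψ : StateSpace S) {I : Set ℝ} (hI : MeasurableSet I) (hfin : volume I ≠ ⊤) :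
    hτ.measure (resolvent S ψ) I ≤ volume I * ‖ψ‖ₑ ^ 2 := by
  obtain ⟨B, hB⟩ := exists_sqrt_of_isPositive (hτ.positive I hI)
  have hA : MeasurableSet {z : ℝ × ℝ | z.2 + z.1 ∈ I} :=
    (measurable_snd.add measurable_fst) hI
  have hmeas : Measurable fun s : ℝ => hτ.measure ψ ((fun t => t + s) ⁻¹' I) :=
    measurable_measure_prodMk_left hA
  -- Tonelli for the set of `(s, t)` with `t + s ∈ I`: every slice at fixed `t` is a translate of
  -- `I`.
  have hint : ∫⁻ s, hτ.measure ψ ((fun t => t + s) ⁻¹' I) = volume I * ‖ψ‖ₑ ^ 2 := by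
    have h1 := Measure.prod_apply (μ := (volume : Measure ℝ)) (ν := hτ.measure ψ) hA
    have h2 := Measure.prod_apply_symm (μ := (volume : Measure ℝ)) (ν := hτ.measure ψ) hA
    rw [h1] at h2
    refine h2.trans ?_
    have h3 : ∀ y : ℝ, volume ((fun x => (x, y)) ⁻¹' {z : ℝ × ℝ | z.2 + z.1 ∈ I}) = volume I :=
      fun y => measure_preimage_add volume y I
    simp_rw [h3]
    rw [lintegral_const, hτ.measure_univ]
  have hg : ∀ s, ‖B (timeTranslation S s ψ)‖ ^ 2
      = (hτ.measure ψ ((fun t => t + s) ⁻¹' I)).toReal := fun s => by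
    rw [← measure_timeTranslation hτ hc s ψ hI]
    have := hτ.inner_eq (timeTranslation S s ψ) hI
    rw [hB, inner_self_eq_norm_sq_complex] at this
    exact_mod_cast this
  have hgi : Integrable fun s => ‖B (timeTranslation S s ψ)‖ ^ 2 := by
    simp_rw [hg]
    refine integrable_toReal_of_lintegral_ne_top hmeas.aemeasurable ?_
    rw [hint]
    exact ENNReal.mul_ne_top hfin (by simp)
  have hgint : ∫ s, ‖B (timeTranslation S s ψ)‖ ^ 2 = (volume I * ‖ψ‖ₑ ^ 2).toReal := by
    simp_rw [hg]
    rw [integral_toReal hmeas.aemeasurable (Eventually.of_forall fun s => measure_lt_top _ _), hint]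
  set X : ℝ := ‖B (resolvent S ψ)‖ with hX
  -- Write `BRψ` as a Laplace transform and use `XY ≤ X²/2 + Y²/2`. The weight `exp(-s)` is kept on
  -- the constant `X²`, where it integrates to `1`, and bounded by `1` on `Y²`, which is integrable
  -- by itself. Half of `X²` is then absorbed on the left.
  have key : X ^ 2 ≤ X ^ 2 / 2 + (volume I * ‖ψ‖ₑ ^ 2).toReal / 2 := by
    have h1 : ((X ^ 2 : ℝ) : ℂ) = ∫ s in Set.Ioi (0 : ℝ), (Real.exp (-s) : ℂ) *
        inner ℂ (B (resolvent S ψ)) (B (timeTranslation S s ψ)) := by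
      have h2 := inner_resolvent (ContinuousLinearMap.adjoint B (B (resolvent S ψ))) ψ
      simp_rw [ContinuousLinearMap.adjoint_inner_left] at h2
      rw [← h2, inner_self_eq_norm_sq_complex]
    have h3 : ‖∫ s in Set.Ioi (0 : ℝ), (Real.exp (-s) : ℂ) *
        inner ℂ (B (resolvent S ψ)) (B (timeTranslation S s ψ))‖
        ≤ ∫ s in Set.Ioi (0 : ℝ), (Real.exp (-s) * (X ^ 2 / 2) +
          ‖B (timeTranslation S s ψ)‖ ^ 2 / 2) := by
      refine norm_integral_le_of_norm_le
        (((integrableOn_exp_neg_Ioi 0).mul_const _).add (hgi.restrict.div_const 2)) ?_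
      filter_upwards [ae_restrict_mem measurableSet_Ioi] with s hs
      have hs0 : (0 : ℝ) < s := hs
      rw [norm_mul, Complex.norm_real, Real.norm_of_nonneg (Real.exp_pos _).le]
      have h4 := norm_inner_le_norm (𝕜 := ℂ) (B (resolvent S ψ)) (B (timeTranslation S s ψ))
      have h5 : Real.exp (-s) ≤ 1 := Real.exp_le_one_iff.2 (by linarith)
      have h6 := Real.exp_pos (-s)
      set Y : ℝ := ‖B (timeTranslation S s ψ)‖
      calc Real.exp (-s) * ‖inner ℂ (B (resolvent S ψ)) (B (timeTranslation S s ψ))‖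
          ≤ Real.exp (-s) * (X ^ 2 / 2 + Y ^ 2 / 2) := by
            refine mul_le_mul_of_nonneg_left (h4.trans ?_) h6.le
            nlinarith [sq_nonneg (X - Y)]
        _ ≤ Real.exp (-s) * (X ^ 2 / 2) + Y ^ 2 / 2 := by
            nlinarith [sq_nonneg Y]
    rw [← h1, Complex.norm_real, Real.norm_of_nonneg (by positivity),
      integral_add ((integrableOn_exp_neg_Ioi 0).mul_const _) (hgi.restrict.div_const 2),
      integral_mul_const, integral_exp_neg_Ioi_zero, one_mul, integral_div] at h3
    have h7 : ∫ s in Set.Ioi (0 : ℝ), ‖B (timeTranslation S s ψ)‖ ^ 2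
        ≤ (volume I * ‖ψ‖ₑ ^ 2).toReal := by
      rw [← hgint]
      exact setIntegral_le_integral hgi (Eventually.of_forall fun s => by positivity)
    linarith
  have hne : volume I * ‖ψ‖ₑ ^ 2 ≠ ⊤ := ENNReal.mul_ne_top hfin (by simp)
  rw [hτ.measure_apply _ hI, hB, inner_self_eq_norm_sq_complex, Complex.ofReal_re,
    ENNReal.ofReal_le_iff_le_toReal hne]
  linarith

theorem measure_resolvent_absolutelyContinuous (hτ : IsNormalizedPOVM τ) (hc : IsCovariant S τ)
    (ψ : StateSpace S) : hτ.measure (resolvent S ψ) ≪ volume :=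
  Measure.AbsolutelyContinuous.mk fun I hI h => by
    have := measure_resolvent_le hτ hc ψ hI (by simp [h])
    simpa [h] using this

/-- The time density of `(1 - i H)⁻¹ ψ` is the value of a fixed positive quadratic form along the
time translates of `ψ`. -/
theorem exists_density_operator (hτ : IsNormalizedPOVM τ) (hc : IsCovariant S τ) :
    ∃ B : StateSpace S →L[ℂ] StateSpace S, ∀ ψ I, MeasurableSet I →
      hτ.measure (resolvent S ψ) I = ∫⁻ t in I, ‖B (timeTranslation S (-t) ψ)‖ₑ ^ 2 := by
  let ε : ℕ → ℝ := fun n => 1 / ((n : ℝ) + 1)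
  have hε : ∀ n, 0 < ε n := fun n => by positivity
  have hε0 : Tendsto ε atTop (𝓝[>] 0) :=
    tendsto_nhdsWithin_iff.2 ⟨tendsto_one_div_add_atTop_nhds_zero_nat,
      Eventually.of_forall hε⟩
  -- The averages over `[-ε, ε]` need not converge weakly for every `ψ`, so a limit is selected by a
  -- nonprincipal ultrafilter.
  let l : Ultrafilter ℕ := hyperfilter ℕ
  have hl : (l : Filter ℕ) ≤ atTop := by
    rw [← Nat.cofinite_eq_atTop]
    exact hyperfilter_le_cofinite
  let A : ℕ → StateSpace S →L[ℂ] StateSpace S := fun n => (((2 * ε n)⁻¹ : ℝ) : ℂ) •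
    (ContinuousLinearMap.adjoint (resolvent S) ∘L τ (Metric.closedBall 0 (ε n)) ∘L resolvent S)
  have hAin : ∀ n ψ, (inner ℂ ψ (A n ψ)).re = (hτ.measure (resolvent S ψ)
      (Metric.closedBall 0 (ε n)) / volume (Metric.closedBall (0 : ℝ) (ε n))).toReal := by
    intro n ψ
    have h1 : inner ℂ ψ (A n ψ) = (((2 * ε n)⁻¹ : ℝ) : ℂ) *
        ((hτ.measure (resolvent S ψ) (Metric.closedBall 0 (ε n))).toReal : ℂ) := by
      simp only [A, _root_.smul_apply, ContinuousLinearMap.comp_apply,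
        inner_smul_right, ContinuousLinearMap.adjoint_inner_right]
      rw [hτ.inner_eq _ Metric.isClosed_closedBall.measurableSet]
    rw [h1, ← Complex.ofReal_mul, Complex.ofReal_re, ENNReal.toReal_div, Real.volume_closedBall,
      ENNReal.toReal_ofReal (by have := hε n; positivity), div_eq_inv_mul]
  obtain ⟨B, hB⟩ := exists_sqrt_weak_limit l A
    (fun n => by
      refine ContinuousLinearMap.IsPositive.smul_of_nonneg ?_ ?_
      · have := (hτ.positive (Metric.closedBall 0 (ε n))
          Metric.isClosed_closedBall.measurableSet).adjoint_conj (resolvent S)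
        exact this
      · have := hε n
        rw [Complex.zero_le_real]
        positivity)
    (fun n ψ => by
      rw [hAin]
      refine ENNReal.toReal_le_of_le_ofReal (by positivity) ?_
      refine ENNReal.div_le_of_le_mul' ?_
      rw [ENNReal.ofReal_pow (norm_nonneg _), ofReal_norm]
      exact measure_resolvent_le hτ hc ψ Metric.isClosed_closedBall.measurableSet
        (by rw [Real.volume_closedBall]; exact ENNReal.ofReal_ne_top))
  refine ⟨B, fun ψ I hI => ?_⟩
  -- Covariance identifies the average over the ball at `t` for `Rψ` with that over the ball at `0`
  -- for `R U(-t)ψ`. At almost every `t` these averages genuinely converge to the derivative, so the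
  -- ultrafilter limit must agree with it.
  have hae : ∀ᵐ t : ℝ, (hτ.measure (resolvent S ψ)).rnDeriv volume t
      = ‖B (timeTranslation S (-t) ψ)‖ₑ ^ 2 := by
    filter_upwards [Besicovitch.ae_tendsto_rnDeriv (hτ.measure (resolvent S ψ)) volume,
      Measure.rnDeriv_lt_top (hτ.measure (resolvent S ψ)) volume] with t h1 h2
    have h3 := ((ENNReal.tendsto_toReal h2.ne).comp (h1.comp hε0)).mono_left hl
    have h4 := hB (timeTranslation S (-t) ψ)
    have h5 := tendsto_nhds_unique (h4.congr fun n => ?_) h3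
    · rw [← ENNReal.ofReal_toReal h2.ne, ← h5, ENNReal.ofReal_pow (norm_nonneg _), ofReal_norm]
    · rw [hAin, resolvent_timeTranslation, measure_timeTranslation hτ hc _ _
        Metric.isClosed_closedBall.measurableSet]
      have e : (fun x => x + -t) ⁻¹' Metric.closedBall 0 (ε n) = Metric.closedBall t (ε n) := by
        ext x
        simp [Real.dist_eq, sub_eq_add_neg]
      simp [e, Real.volume_closedBall]
  rw [← setLIntegral_congr_fun_ae hI (hae.mono fun t h _ => h),
    Measure.setLIntegral_rnDeriv (measure_resolvent_absolutelyContinuous hτ hc ψ)]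

end

section

/-! ### Inner products of states as integrals over the energy -/

variable {ι : Type*} [MeasurableSpace ι] [Countable ι] [DiscreteMeasurableSpace ι]
  {S : ι → Set ℝ}

theorem integral_stateMeasure (hS : ∀ σ, MeasurableSet (S σ)) {f : ι × ℝ → ℂ}
    (hf : Integrable f (stateMeasure S)) :
    Integrable (fun E => ∑' σ, (S σ).indicator (fun E => f (σ, E)) E) ∧
      ∫ p, f p ∂stateMeasure S = ∫ E, ∑' σ, (S σ).indicator (fun E => f (σ, E)) E := by
  have hm := measurableSet_spectrum hS
  have hf' := (integrable_indicator_iff hm).2 hf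
  have e : (fun E => ∫ σ, {p : ι × ℝ | p.2 ∈ S p.1}.indicator f (σ, E) ∂Measure.count)
      =ᵐ[volume] fun E => ∑' σ, (S σ).indicator (fun E => f (σ, E)) E := by
    filter_upwards [hf'.prod_left_ae] with E hE
    rw [integral_countable hE]
    refine tsum_congr fun σ => ?_
    rw [Measure.real, Measure.count_singleton, ENNReal.toReal_one, one_smul]
    rfl
  refine ⟨hf'.integral_prod_right.congr e, ?_⟩
  rw [stateMeasure, ← integral_indicator hm, integral_prod_symm _ hf', integral_congr_ae e]

/-- `∑_σ conj (b_σ(E)) ψ_σ(E)`. -/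
def overlap (b ψ : StateSpace S) (E : ℝ) : ℂ :=
  ∑' σ, starRingEnd ℂ (component S b σ E) * component S ψ σ E

omit [Countable ι] [DiscreteMeasurableSpace ι] in
theorem overlap_eq (b ψ : StateSpace S) (E : ℝ) :
    overlap b ψ E = ∑' σ, (S σ).indicator (fun E => inner ℂ (b (σ, E)) (ψ (σ, E))) E := by
  refine tsum_congr fun σ => ?_
  by_cases h : E ∈ S σ
  · simp [component, h, mul_comm]
  · simp [component, h]

theorem integrable_overlap (hS : ∀ σ, MeasurableSet (S σ)) (b ψ : StateSpace S) :
    Integrable (overlap b ψ) :=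
  (integral_stateMeasure hS (L2.integrable_inner (𝕜 := ℂ) b ψ)).1.congr
    (Eventually.of_forall fun E => (overlap_eq b ψ E).symm)

theorem inner_timeTranslation (hS : ∀ σ, MeasurableSet (S σ)) (s : ℝ) (b ψ : StateSpace S) :
    inner ℂ b (timeTranslation S s ψ) = ∫ E : ℝ, Complex.exp (Complex.I * s * E) * overlap b ψ E := by
  rw [L2.inner_def, (integral_stateMeasure hS
    (L2.integrable_inner (𝕜 := ℂ) b (timeTranslation S s ψ))).2]
  refine integral_congr_ae ?_
  filter_upwards [ae_component_of_ae_stateMeasure hS (timeTranslation_ae s ψ)] with E hE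
  rw [overlap_eq, ← tsum_mul_left]
  refine tsum_congr fun σ => ?_
  by_cases h : E ∈ S σ
  · simp only [h, Set.indicator_of_mem, hE σ h, phase, RCLike.inner_apply, mul_assoc]
  · simp [h]

/-! ### The kernel of a family of vectors -/

section Kernel

variable {Γ : Type*} (b : Γ → StateSpace S)

/-- The kernel `√(2π) conj (b_{γσ}(E)) (1 - i E)`. -/
def kernelOf (γ : Γ) (σ : ι) (E : ℝ) : ℂ :=
  (Real.sqrt (2 * Real.pi) : ℂ) * (1 - Complex.I * E) * starRingEnd ℂ (b γ (σ, E))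

omit [Countable ι] [DiscreteMeasurableSpace ι] in
theorem measurable_kernelOf (γ : Γ) (σ : ι) : Measurable (kernelOf b γ σ) := by
  have h : Measurable fun E : ℝ => b γ (σ, E) :=
    (Lp.stronglyMeasurable (b γ)).measurable.comp measurable_prodMk_left
  have h' := Complex.continuous_conj.measurable.comp h
  exact Measurable.mul (by fun_prop) h'

/-- The factor `1 - iE` of the kernel undoes the resolvent. What remains is a pointwise pairing of
two states, hence integrable in `E`. -/
theorem energyAmplitude_kernelOf (hS : ∀ σ, MeasurableSet (S σ)) (γ : Γ) (ψ : StateSpace S) :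
    energyAmplitude S (kernelOf b) (resolvent S ψ) γ
      =ᵐ[volume] fun E => (Real.sqrt (2 * Real.pi) : ℂ) * overlap (b γ) ψ E := by
  filter_upwards [ae_component_of_ae_stateMeasure hS (resolvent_ae ψ)] with E hE
  rw [energyAmplitude, overlap, ← tsum_mul_left]
  refine tsum_congr fun σ => ?_
  by_cases h : E ∈ S σ
  · have := one_sub_I_mul_ne_zero E
    simp only [component, h, Set.indicator_of_mem, hE σ h, kernelOf, resolventFun]
    field_simp
  · simp [component, h]

theorem integrable_energyAmplitude_kernelOf (hS : ∀ σ, MeasurableSet (S σ)) (γ : Γ)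
    (ψ : StateSpace S) : Integrable (energyAmplitude S (kernelOf b) (resolvent S ψ) γ) :=
  ((integrable_overlap hS (b γ) ψ).const_mul _).congr (energyAmplitude_kernelOf b hS γ ψ).symm

theorem timeAmplitude_kernelOf (hS : ∀ σ, MeasurableSet (S σ)) (γ : Γ) (ψ : StateSpace S) (t : ℝ) :
    timeAmplitude (energyAmplitude S (kernelOf b) (resolvent S ψ) γ) t
      = inner ℂ (b γ) (timeTranslation S (-t) ψ) := by
  rw [inner_timeTranslation hS, timeAmplitude, ← integral_const_mul]
  refine integral_congr_ae ?_
  filter_upwards [energyAmplitude_kernelOf b hS γ ψ] with E hE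
  have h : (Real.sqrt (2 * Real.pi) : ℂ) ≠ 0 := by
    have : Real.sqrt (2 * Real.pi) ≠ 0 := by positivity
    exact_mod_cast this
  have h2 : -Complex.I * (t : ℂ) * E = Complex.I * ((-t : ℝ) : ℂ) * E := by
    push_cast
    ring
  rw [hE, h2, Complex.ofReal_inv]
  field_simp

end Kernel

/-- Parseval expands the density `‖B U(-t)ψ‖²` into coefficients `(e_γ, B U(-t)ψ) = (B† e_γ,
U(-t)ψ)`, which are the time amplitudes of the kernel of the vectors `B† e_γ`. -/
theorem exists_kernel (hS : ∀ σ, MeasurableSet (S σ))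
    {τ : Set ℝ → StateSpace S →L[ℂ] StateSpace S} (hτ : IsNormalizedPOVM τ)
    (hc : IsCovariant S τ) :
    ∃ (Γ : Type) (_ : Countable Γ) (F : Γ → ι → ℝ → ℂ), (∀ γ σ, Measurable (F γ σ)) ∧
      (∀ γ ψ, Integrable (energyAmplitude S F (resolvent S ψ) γ)) ∧
      ∀ ψ I, MeasurableSet I → hτ.measure (resolvent S ψ) I
        = ∑' γ, ∫⁻ t in I, ‖timeAmplitude (energyAmplitude S F (resolvent S ψ) γ) t‖ₑ ^ 2 := by
  have : Fact ((2 : ℝ≥0∞) ≠ ⊤) := ⟨by simp⟩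
  obtain ⟨B, hB⟩ := exists_density_operator hτ hc
  obtain ⟨Γ, hΓ, e, he⟩ := exists_countable_parseval (H := StateSpace S)
  refine ⟨Γ, hΓ, kernelOf fun γ => ContinuousLinearMap.adjoint B (e γ), measurable_kernelOf _,
    integrable_energyAmplitude_kernelOf _ hS, fun ψ I hI => ?_⟩
  rw [hB ψ I hI, ← lintegral_tsum]
  · refine lintegral_congr fun t => ?_
    rw [← he]
    refine tsum_congr fun γ => ?_
    rw [timeAmplitude_kernelOf _ hS, ContinuousLinearMap.adjoint_inner_left]
  · intro γ
    rw [timeAmplitude_eq_rescale]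
    exact ((aestronglyMeasurable_rescale (continuous_fourier
      (integrable_energyAmplitude_kernelOf _ hS γ ψ)).aestronglyMeasurable).aemeasurable.enorm.pow_const
      2).restrict

/-! ### Orthonormality of the columns -/

theorem polarization_complex (x y : ℂ) : starRingEnd ℂ x * y =
    (((‖x + y‖ ^ 2 : ℝ) : ℂ) - ((‖x + -1 * y‖ ^ 2 : ℝ) : ℂ)
      - Complex.I * ((‖x + Complex.I * y‖ ^ 2 : ℝ) : ℂ)
      + Complex.I * ((‖x + -Complex.I * y‖ ^ 2 : ℝ) : ℂ)) / 4 := by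
  simp only [← Complex.normSq_eq_norm_sq, ← Complex.mul_conj, map_add, map_mul, map_neg, map_one,
    Complex.conj_I]
  ring_nf
  simp only [Complex.I_sq]
  ring_nf

theorem hasSum_conj_mul_of_hasSum_norm_sq {Γ : Type*} {x y : Γ → ℂ} {n : ℂ → ℝ}
    (h : ∀ c : ℂ, c = 1 ∨ c = -1 ∨ c = Complex.I ∨ c = -Complex.I →
      HasSum (fun γ => ‖x γ + c * y γ‖ ^ 2) (n c)) :
    HasSum (fun γ => starRingEnd ℂ (x γ) * y γ)
      (((n 1 : ℂ) - n (-1) - Complex.I * n Complex.I + Complex.I * n (-Complex.I)) / 4) := by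
  simp_rw [polarization_complex]
  have h' := fun c hc => Complex.hasSum_ofReal.2 (h c hc)
  have h1 := h' 1 (by simp)
  simp only [one_mul] at h1
  exact (((h1.sub (h' (-1) (by simp))).sub ((h' Complex.I (by simp)).mul_left _)).add
    ((h' (-Complex.I) (by simp)).mul_left _)).div_const 4

/-- A state of the form `v_σ 1_A(E)`. -/
theorem memLp_test (hS : ∀ σ, MeasurableSet (S σ)) {v : ι → ℂ} (hv : ∑' σ, ‖v σ‖ₑ ^ 2 ≠ ⊤)
    {A : Set ℝ} (hA : MeasurableSet A) (hfin : volume A ≠ ⊤) :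
    MemLp (fun p : ι × ℝ => A.indicator (fun _ => v p.1) p.2) 2 (stateMeasure S) := by
  have hm : Measurable fun p : ι × ℝ => A.indicator (fun _ => v p.1) p.2 := by
    have : (fun p : ι × ℝ => A.indicator (fun _ => v p.1) p.2)
        = (Prod.snd ⁻¹' A).indicator fun p => v p.1 := rfl
    rw [this]
    exact ((Measurable.of_discrete (f := v)).comp measurable_fst).indicator (measurable_snd hA)
  rw [memLp_two_iff hm.aestronglyMeasurable, lintegral_stateMeasure hS (hm.enorm.pow_const 2)]
  calc ∫⁻ E, ∑' σ, (S σ).indicator (fun E => ‖A.indicator (fun _ => v σ) E‖ₑ ^ 2) E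
      ≤ ∫⁻ E, A.indicator (fun _ => ∑' σ, ‖v σ‖ₑ ^ 2) E := by
        refine lintegral_mono fun E => ?_
        by_cases hE : E ∈ A
        · simp only [hE, Set.indicator_of_mem]
          refine ENNReal.tsum_le_tsum fun σ => ?_
          by_cases hσ : E ∈ S σ <;> simp [hE, hσ]
        · simp [hE]
    _ < ⊤ := by
        rw [lintegral_indicator hA, setLIntegral_const]
        exact ENNReal.mul_lt_top hv.lt_top hfin.lt_top

theorem component_resolvent_test (hS : ∀ σ, MeasurableSet (S σ)) {v : ι → ℂ} {A : Set ℝ}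
    (hAS : ∀ σ, v σ ≠ 0 → A ⊆ S σ)
    (hmem : MemLp (fun p : ι × ℝ => A.indicator (fun _ => v p.1) p.2) 2 (stateMeasure S)) :
    ∀ᵐ E : ℝ, ∀ σ, component S (resolvent S hmem.toLp) σ E
      = A.indicator (fun E => resolventFun E * v σ) E := by
  filter_upwards [ae_component_of_ae_stateMeasure hS (resolvent_ae hmem.toLp),
    ae_component_of_ae_stateMeasure hS hmem.coeFn_toLp] with E h1 h2 σ
  by_cases h : E ∈ S σ
  · simp only [component, h, Set.indicator_of_mem, h1 σ h, h2 σ h]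
    by_cases hE : E ∈ A <;> simp [hE]
  · simp only [component, h, not_false_eq_true, Set.indicator_of_notMem]
    by_cases hE : E ∈ A
    · have : v σ = 0 := by
        by_contra hv
        exact h (hAS σ hv hE)
      simp [this]
    · simp [hE]

omit [MeasurableSpace ι] [Countable ι] [DiscreteMeasurableSpace ι] in
theorem tsum_mul_single_add_single [DecidableEq ι] (f : ι → ℂ) (σ σ' : ι) (c : ℂ) :
    ∑' j, f j * (Pi.single σ 1 + Pi.single σ' c : ι → ℂ) j = f σ + c * f σ' := by
  have h1 : HasSum (fun j => f j * (Pi.single σ 1 : ι → ℂ) j) (f σ) := by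
    convert! hasSum_single (f := fun j => f j * (Pi.single σ 1 : ι → ℂ) j) σ ?_ using 1
    · simp
    · intro j hj
      simp [hj]
  have h2 : HasSum (fun j => f j * (Pi.single σ' c : ι → ℂ) j) (c * f σ') := by
    convert! hasSum_single (f := fun j => f j * (Pi.single σ' c : ι → ℂ) j) σ' ?_ using 1
    · simp [mul_comm]
    · intro j hj
      simp [hj]
  rw [← (h1.add h2).tsum_eq]
  simp [mul_add]

omit [MeasurableSpace ι] [Countable ι] [DiscreteMeasurableSpace ι] in
theorem tsum_enorm_sq_single_add_single [DecidableEq ι] (σ σ' : ι) (c : ℂ) :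
    ∑' j, ‖(Pi.single σ 1 + Pi.single σ' c : ι → ℂ) j‖ₑ ^ 2
      = ENNReal.ofReal (if σ = σ' then ‖1 + c‖ ^ 2 else 1 + ‖c‖ ^ 2) := by
  have hs : ∀ z : ℂ, ‖z‖ₑ ^ 2 = ENNReal.ofReal (‖z‖ ^ 2) := fun z => by
    rw [ENNReal.ofReal_pow (norm_nonneg _), ofReal_norm]
  by_cases h : σ = σ'
  · subst h
    have h0 : ∀ j ≠ σ, ‖(Pi.single σ 1 + Pi.single σ c : ι → ℂ) j‖ₑ ^ 2 = 0 := fun j hj => by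
      simp [hj]
    rw [tsum_eq_single σ h0, hs, Pi.add_apply, Pi.single_eq_same, Pi.single_eq_same, if_pos rfl]
  · have h0 : ∀ j ∉ ({σ, σ'} : Finset ι),
        ‖(Pi.single σ 1 + Pi.single σ' c : ι → ℂ) j‖ₑ ^ 2 = 0 := fun j hj => by
      simp only [Finset.mem_insert, Finset.mem_singleton, not_or] at hj
      simp [hj.1, hj.2]
    rw [tsum_eq_sum h0, Finset.sum_pair h]
    have h' : σ' ≠ σ := Ne.symm h
    simp only [Pi.add_apply, Pi.single_eq_same, ne_eq, h, h', not_false_eq_true,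
      Pi.single_eq_of_ne, add_zero, zero_add, if_false, hs]
    rw [← ENNReal.ofReal_add (by positivity) (by positivity)]
    simp

/-- The isometry is tested on `R` applied to `(e_σ + c e_σ') 1_A`, for every `A ⊆ S σ ∩ S σ'` of
finite volume. Equal integrals over all such `A` force equal integrands, and the common nonzero
factor `|resolventFun E|²` cancels. For `σ = σ'` the vector is `(1 + c) e_σ`, hence the two cases.
-/
theorem ae_hasSum_of_isometric (hS : ∀ σ, MeasurableSet (S σ)) {Γ : Type*} [Countable Γ]
    {F : Γ → ι → ℝ → ℂ} (hm : ∀ γ σ, Measurable (F γ σ))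
    (hiso : ∀ ψ, ∑' γ, ∫⁻ E, ‖energyAmplitude S F (resolvent S ψ) γ E‖ₑ ^ 2
      = ‖resolvent S ψ‖ₑ ^ 2) [DecidableEq ι] (σ σ' : ι) (c : ℂ) :
    ∀ᵐ E, E ∈ S σ → E ∈ S σ' → HasSum (fun γ => ‖F γ σ E + c * F γ σ' E‖ ^ 2)
      (if σ = σ' then ‖1 + c‖ ^ 2 else 1 + ‖c‖ ^ 2) := by
  set v : ι → ℂ := Pi.single σ 1 + Pi.single σ' c with hvdef
  set n : ℝ := if σ = σ' then ‖1 + c‖ ^ 2 else 1 + ‖c‖ ^ 2 with hn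
  have hn0 : 0 ≤ n := by
    rw [hn]
    split_ifs <;> positivity
  have hv : ∑' j, ‖v j‖ₑ ^ 2 = ENNReal.ofReal n := tsum_enorm_sq_single_add_single σ σ' c
  have hm1 : ∀ γ, Measurable fun E => ‖F γ σ E + c * F γ σ' E‖ₑ ^ 2 := fun γ =>
    (((hm γ σ).add ((hm γ σ').const_mul c)).enorm).pow_const 2
  have hmr : Measurable fun E => ‖resolventFun E‖ₑ ^ 2 := measurable_resolventFun.enorm.pow_const 2
  have hT : MeasurableSet (S σ ∩ S σ') := (hS σ).inter (hS σ')
  have key : ∀ A, MeasurableSet A → volume A < ⊤ → A ⊆ S σ ∩ S σ' →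
      ∫⁻ E in A, ‖resolventFun E‖ₑ ^ 2 * ∑' γ, ‖F γ σ E + c * F γ σ' E‖ₑ ^ 2
        = ∫⁻ E in A, ‖resolventFun E‖ₑ ^ 2 * ENNReal.ofReal n := by
    intro A hA hfin hAS
    have hmem := memLp_test hS (v := v) (by rw [hv]; exact ENNReal.ofReal_ne_top) hA hfin.ne
    have hcomp := component_resolvent_test hS (v := v) (A := A) (fun j hj => by
      by_cases h1 : j = σ
      · exact h1 ▸ fun E hE => (hAS hE).1
      · by_cases h2 : j = σ'
        · exact h2 ▸ fun E hE => (hAS hE).2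
        · exact absurd (by simp [hvdef, h1, h2]) hj) hmem
    have h := hiso hmem.toLp
    rw [enorm_sq_stateSpace hS] at h
    have hamp : ∀ᵐ E, ∀ γ, energyAmplitude S F (resolvent S hmem.toLp) γ E
        = A.indicator (fun E => resolventFun E * (F γ σ E + c * F γ σ' E)) E := by
      filter_upwards [hcomp] with E hE γ
      rw [energyAmplitude]
      simp_rw [hE]
      by_cases hEA : E ∈ A
      · simp only [hEA, Set.indicator_of_mem]
        rw [← tsum_mul_single_add_single (fun j => F γ j E) σ σ' c, ← tsum_mul_left]
        exact tsum_congr fun j => mul_left_comm _ _ _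
      · simp [hEA]
    have hl : ∑' γ, ∫⁻ E, ‖energyAmplitude S F (resolvent S hmem.toLp) γ E‖ₑ ^ 2
        = ∫⁻ E in A, ‖resolventFun E‖ₑ ^ 2 * ∑' γ, ‖F γ σ E + c * F γ σ' E‖ₑ ^ 2 := by
      simp_rw [← ENNReal.tsum_mul_left]
      rw [lintegral_tsum fun γ => (Measurable.fun_mul hmr (hm1 γ)).aemeasurable]
      refine tsum_congr fun γ => ?_
      rw [← lintegral_indicator hA]
      refine lintegral_congr_ae ?_
      filter_upwards [hamp] with E hE
      rw [hE]
      by_cases hEA : E ∈ A <;> simp [hEA, enorm_mul, mul_pow]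
    have hr : ∫⁻ E, ∑' j, ‖component S (resolvent S hmem.toLp) j E‖ₑ ^ 2
        = ∫⁻ E in A, ‖resolventFun E‖ₑ ^ 2 * ENNReal.ofReal n := by
      rw [← lintegral_indicator hA]
      refine lintegral_congr_ae ?_
      filter_upwards [hcomp] with E hE
      simp_rw [hE]
      by_cases hEA : E ∈ A
      · simp only [hEA, Set.indicator_of_mem]
        rw [← hv, ← ENNReal.tsum_mul_left]
        exact tsum_congr fun j => by rw [enorm_mul, mul_pow]
      · simp [hEA]
    rw [← hl, h, hr]
  have hae : ∀ᵐ E ∂volume.restrict (S σ ∩ S σ'),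
      ‖resolventFun E‖ₑ ^ 2 * ∑' γ, ‖F γ σ E + c * F γ σ' E‖ₑ ^ 2
        = ‖resolventFun E‖ₑ ^ 2 * ENNReal.ofReal n := by
    refine ae_eq_of_forall_setLIntegral_eq_of_sigmaFinite (hmr.mul (Measurable.tsum hm1))
      (hmr.mul_const _) fun A hA hfin => ?_
    rw [Measure.restrict_restrict hA]
    rw [Measure.restrict_apply hA] at hfin
    exact key _ (hA.inter hT) hfin Set.inter_subset_right
  filter_upwards [(ae_restrict_iff' hT).1 hae] with E hE h1 h2
  have h3 := hE ⟨h1, h2⟩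
  rw [ENNReal.mul_right_inj (by simpa using resolventFun_ne_zero E) (by simp)] at h3
  have hs : Summable fun γ => ‖F γ σ E + c * F γ σ' E‖ ^ 2 :=
    summable_norm_sq_iff.2 (by rw [h3]; exact ENNReal.ofReal_ne_top)
  rw [tsum_enorm_sq_eq hs, ENNReal.ofReal_eq_ofReal_iff (tsum_nonneg fun _ => by positivity) hn0]
    at h3
  rw [← h3]
  exact hs.hasSum

theorem isIsometricKernel_of_isometric (hS : ∀ σ, MeasurableSet (S σ)) {Γ : Type*} [Countable Γ]
    {F : Γ → ι → ℝ → ℂ} (hm : ∀ γ σ, Measurable (F γ σ))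
    (hiso : ∀ ψ, ∑' γ, ∫⁻ E, ‖energyAmplitude S F (resolvent S ψ) γ E‖ₑ ^ 2
      = ‖resolvent S ψ‖ₑ ^ 2) : IsIsometricKernel S F := by
  classical
  refine ⟨hm, fun σ σ' => ?_⟩
  have h := ae_hasSum_of_isometric hS hm hiso σ σ'
  -- The four values of `c` needed for polarization; the squared norms of `e_σ + c e_σ'` polarize to
  -- `δ_{σσ'}`.
  filter_upwards [h 1, h (-1), h Complex.I, h (-Complex.I)] with E h1 h2 h3 h4 hσ hσ'
  convert! hasSum_conj_mul_of_hasSum_norm_sq (x := fun γ => F γ σ E) (y := fun γ => F γ σ' E)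
    (n := fun c => if σ = σ' then ‖1 + c‖ ^ 2 else 1 + ‖c‖ ^ 2) ?_ using 1
  · by_cases hσσ : σ = σ'
    · have e1 : ‖(1 : ℂ) + Complex.I‖ ^ 2 = 2 := by
        rw [← Complex.normSq_eq_norm_sq]
        norm_num [Complex.normSq_apply]
      have e2 : ‖(1 : ℂ) + -Complex.I‖ ^ 2 = 2 := by
        rw [← Complex.normSq_eq_norm_sq]
        norm_num [Complex.normSq_apply]
      simp only [hσσ, if_true, e1, e2]
      norm_num
    · simp [hσσ]
  · rintro c (rfl | rfl | rfl | rfl)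
    exacts [h1 hσ hσ', h2 hσ hσ', h3 hσ hσ', h4 hσ hσ']

/-! ### The characterization -/

theorem exists_isIsometricKernel_hasDensity (hS : ∀ σ, MeasurableSet (S σ))
    {τ : Set ℝ → StateSpace S →L[ℂ] StateSpace S} (hτ : IsNormalizedPOVM τ)
    (hc : IsCovariant S τ) :
    ∃ (Γ : Type) (_ : Countable Γ) (F : Γ → ι → ℝ → ℂ),
      IsIsometricKernel S F ∧ HasDensity S τ F := by
  obtain ⟨Γ, hΓ, F, hm, hi, hμ⟩ := exists_kernel hS hτ hc
  have hiso : ∀ ψ, ∑' γ, ∫⁻ E, ‖energyAmplitude S F (resolvent S ψ) γ E‖ₑ ^ 2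
      = ‖resolvent S ψ‖ₑ ^ 2 := by
    intro ψ
    have h := hμ ψ Set.univ MeasurableSet.univ
    rw [hτ.measure_univ, Measure.restrict_univ] at h
    rw [h]
    -- Plancherel needs a square integrable time amplitude; each term is bounded by the finite total
    -- mass `‖Rψ‖²`.
    refine tsum_congr fun γ => lintegral_timeAmplitude (hi γ ψ) ?_
    refine (ENNReal.le_tsum (f := fun γ => ∫⁻ t, ‖timeAmplitude
      (energyAmplitude S F (resolvent S ψ) γ) t‖ₑ ^ 2) γ).trans_lt ?_
    rw [← h]
    simp
  have hF := isIsometricKernel_of_isometric hS hm hiso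
  refine ⟨Γ, hΓ, F, hF, (hF.hasDensity_iff hS τ).2 ?_⟩
  -- The density formula is so far known only for states `Rψ`. It extends by comparing `τ` with the
  -- measure `τ'` of the kernel, whose density formula holds for all states.
  obtain ⟨τ', hτ'⟩ := hF.exists_hasDensity hS
  rw [hF.hasDensity_iff hS] at hτ'
  have hrange : ∀ ψ I, MeasurableSet I → inner ℂ (resolvent S ψ) (τ I (resolvent S ψ))
      = inner ℂ (resolvent S ψ) (τ' I (resolvent S ψ)) := by
    intro ψ I hI
    rw [hτ.inner_eq _ hI, hτ' _ I hI, hμ ψ I hI, hF.setLIntegral_densityFun hS]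
    congr 2
    refine tsum_congr fun γ => lintegral_congr_ae (ae_restrict_of_ae ?_)
    have h := rescale_congr_ae (Lp_fourier_ae_eq (hi γ ψ)
      (hF.memLp_energyAmplitude hS (resolvent S ψ) γ))
    filter_upwards [h] with t ht
    rw [timeAmplitude_eq_rescale, ← ht, timeLp, hF.amplitudeCLM_apply]
  intro ψ I hI
  suffices h : τ I = τ' I by rw [h, hτ' ψ I hI]
  have h1 : ContinuousLinearMap.adjoint (resolvent S) ∘L τ I ∘L resolvent S
      = ContinuousLinearMap.adjoint (resolvent S) ∘L τ' I ∘L resolvent S :=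
    clm_ext_of_inner_self fun φ => by
      simpa [ContinuousLinearMap.adjoint_inner_right] using hrange φ I hI
  -- Density of the range of `R` is now used twice, to remove `R` first from the left argument and
  -- then, via the adjoint, from the right one.
  have h2 : ∀ φ χ, inner ℂ (resolvent S φ) ((τ I - τ' I) (resolvent S χ)) = 0 := fun φ χ => by
    have := congrArg (fun A : StateSpace S →L[ℂ] StateSpace S => inner ℂ φ (A χ)) h1
    simp only [ContinuousLinearMap.comp_apply, ContinuousLinearMap.adjoint_inner_right] at this
    rw [_root_.sub_apply, inner_sub_right, this, sub_self]
  have h3 : ∀ χ, (τ I - τ' I) (resolvent S χ) = 0 := fun χ =>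
    eq_zero_of_inner_resolvent fun φ => by rw [← inner_conj_symm, h2, map_zero]
  have h4 : ∀ φ, ContinuousLinearMap.adjoint (τ I - τ' I) φ = 0 := fun φ =>
    eq_zero_of_inner_resolvent fun χ => by
      rw [ContinuousLinearMap.adjoint_inner_left, h3, inner_zero_right]
  refine sub_eq_zero.1 (ContinuousLinearMap.ext fun φ => ext_inner_left ℂ fun χ => ?_)
  rw [← ContinuousLinearMap.adjoint_inner_left, h4]
  simp

end

end

end TimePOVM


theorem proposition4 {ι : Type*} [Countable ι] [MeasurableSpace ι] [DiscreteMeasurableSpace ι]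
    (S : ι → Set ℝ) (hS : ∀ σ, MeasurableSet (S σ)) :
    (∀ τ : Set ℝ → TimePOVM.StateSpace S →L[ℂ] TimePOVM.StateSpace S,
      (TimePOVM.IsNormalizedPOVM τ ∧ TimePOVM.IsCovariant S τ) ↔
        ∃ (Γ : Type) (_ : Countable Γ) (F : Γ → ι → ℝ → ℂ),
          TimePOVM.IsIsometricKernel S F ∧ TimePOVM.HasDensity S τ F) ∧
    (∀ (Γ : Type) [Countable Γ] (F : Γ → ι → ℝ → ℂ), TimePOVM.IsIsometricKernel S F →
      ∃ τ : Set ℝ → TimePOVM.StateSpace S →L[ℂ] TimePOVM.StateSpace S,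
        TimePOVM.HasDensity S τ F) := by
  refine ⟨fun τ => ⟨fun h => TimePOVM.exists_isIsometricKernel_hasDensity hS h.1 h.2, ?_⟩,
    fun Γ _ F hF => hF.exists_hasDensity hS⟩
  rintro ⟨Γ, _, F, hF, hd⟩
  exact ⟨hF.isNormalizedPOVM hS hd, hF.isCovariant hS hd⟩
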